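/- Let $R$ be a (Hausdorff) topological commutative $\mathbb Q$-algebra of functions of the times $t=(t_1=x,t_2,t_3,\dots)$, with commuting continuous derivations $\partial_{t_n}=\partial/\partial t_n$, $\partial_{t_m}t_n=\delta_{mn}$, $\partial=\partial_x$, in which all sums $\sum_l t_la_l$ converge (for example formal power series in the $t_l$ and possibly further parameters). All operators are formal pseudo-differential operators $\sum_{n\le N}a_n\partial^n$ over $R$; $(A)_+$ and $(A)_-$ denote the differential and the integral part of $A$, $^*$ is the formal adjoint and $A(f)$ is the action on a function. Let $L=\partial+q\partial^{-1}r$ be a solution of the constrained KP hierarchy with $m=1$, that is, $\partial_{t_n}L=[B_n,L]$, $\partial_{t_n}q=B_n(q)$, $\partial_{t_n}r=-B_n^*(r)$ with $B_n=(L^n)_+$, $n\ge1$, where $r$ is invertible and $q$ is not a zero divisor. Let $W=1+\sum_{j\ge1}w_j\partial^{-j}$ be a dressing operator, $L=W\partial W^{-1}$, $\partial_{t_n}W=-(L^n)_-W$, and let $M=WM^{(0)}W^{-1}$, $M^{(0)}=\sum_{l\ge1}l\,t_l\,\partial^{l-1}$, be the Orlov–Schulman operator. For $n\ge0$ put $$X_n^{(1)}=\sum_{j=0}^{n-1}\Big(j-\tfrac{n-1}{2}\Big)L^{n-1-j}(q)\,\partial^{-1}\,(L^*)^j(r),$$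 and $X^{(1)}_{-1}=0$. Here $L(f)=f_x+q\,\partial^{-1}(rf)$ and $L^*(f)=-f_x-r\,\partial^{-1}(qf)$ act on functions through integrals $J_{ij}=\partial^{-1}\big((L^*)^i(r)\,L^j(q)\big)$ in $R$ whose integration constants are chosen consistently with integration by parts, i.e. $J_{i,j+1}-J_{i+1,j}=(L^*)^i(r)\,L^j(q)+J_{i,0}J_{0,j}$ (both sides have the same $x$-derivative). Let $T=T_I(r)=r^{-1}\partial^{-1}r$ and $\widetilde L=TLT^{-1}$, $\widetilde M=TMT^{-1}$. Let $\widetilde q=r^{-1}$, $\widetilde r=-r\,\partial_x\big(r^{-1}L^*(r)\big)$, and let $\widetilde X^{(1)}_n$ be given by the formula for $X^{(1)}_n$ with $(L,q,r)$ replaced by $(\widetilde L,\widetilde q,\widetilde r)$, where $\widetilde L^{j+1}(\widetilde q)=T(L^j(q))=r^{-1}J_{0,j}$ and $(\widetilde L^*)^j(\widetilde r)=(T^*)^{-1}\big((L^*)^{j+1}(r)\big)=-r\,\partial_x\big(r^{-1}(L^*)^{j+1}(r)\big)$. Let $k\ge0$ and let $\partial_k^*$ be an additional symmetry flow, i.e.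 a derivation of $R$ commuting with $\partial$ with $$\partial_k^*L=\big[-(ML^k)_-+X^{(1)}_{k-1},\,L\big].$$ Then $\widetilde L=\partial+\widetilde q\,\partial^{-1}\widetilde r$ is again of cKP form, and $$\partial_k^*\widetilde L=\big[-(\widetilde M\widetilde L^k)_-+\widetilde X^{(1)}_{k-1},\,\widetilde L\big]-\frac{\partial\widetilde L}{\partial t_{k-1}},$$ where the last term is understood to be $0$ for $k=0,1$. -/

import Mathlib

/-- A (formal) pseudo-differential operator `∑_{n ≤ N} a_n ∂^n` with coefficients in the
differential algebra `(R, d)`. -/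
@[ext]
structure PDO {R : Type*} [CommRing R] [Algebra ℚ R] (d : Derivation ℚ R R) where
  /-- the coefficient of `∂^n` -/
  coeff : ℤ → R
  bdd : ∃ N : ℤ, ∀ n : ℤ, N < n → coeff n = 0

namespace PDO

variable {R : Type*} [CommRing R] [Algebra ℚ R] {d : Derivation ℚ R R}

instance : Zero (PDO d) := ⟨⟨fun _ => 0, 0, fun _ _ => rfl⟩⟩

instance : Add (PDO d) := ⟨fun A B => ⟨fun n => A.coeff n + B.coeff n, by
  obtain ⟨a, ha⟩ := A.bdd
  obtain ⟨b, hb⟩ := B.bdd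
  refine ⟨max a b, fun n hn => ?_⟩
  rw [ha n (lt_of_le_of_lt (le_max_left a b) hn),
    hb n (lt_of_le_of_lt (le_max_right a b) hn), add_zero]⟩⟩

instance : Neg (PDO d) := ⟨fun A => ⟨fun n => - A.coeff n, by
  obtain ⟨a, ha⟩ := A.bdd
  exact ⟨a, fun n hn => by rw [ha n hn, neg_zero]⟩⟩⟩

instance : Sub (PDO d) := ⟨fun A B => ⟨fun n => A.coeff n - B.coeff n, by
  obtain ⟨a, ha⟩ := A.bdd
  obtain ⟨b, hb⟩ := B.bdd
  refine ⟨max a b, fun n hn => ?_⟩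
  rw [ha n (lt_of_le_of_lt (le_max_left a b) hn),
    hb n (lt_of_le_of_lt (le_max_right a b) hn), sub_zero]⟩⟩

instance : SMul ℕ (PDO d) := ⟨fun c A => ⟨fun n => c • A.coeff n, by
  obtain ⟨a, ha⟩ := A.bdd
  exact ⟨a, fun n hn => by rw [ha n hn, smul_zero]⟩⟩⟩

instance : SMul ℤ (PDO d) := ⟨fun c A => ⟨fun n => c • A.coeff n, by
  obtain ⟨a, ha⟩ := A.bdd
  exact ⟨a, fun n hn => by rw [ha n hn, smul_zero]⟩⟩⟩

theorem coeff_injective : Function.Injective (PDO.coeff : PDO d → ℤ → R) :=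
  fun _ _ h => PDO.ext h

instance : AddCommGroup (PDO d) :=
  coeff_injective.addCommGroup _ rfl (fun _ _ => rfl) (fun _ => rfl) (fun _ _ => rfl)
    (fun _ _ => rfl) (fun _ _ => rfl)

/-- The operator `f ∂^i`. -/
def mono (f : R) (i : ℤ) : PDO d :=
  ⟨fun n => if n = i then f else 0, i, fun _ hn => if_neg (ne_of_gt hn)⟩

/-- Multiplication by the function `f`. -/
def const (f : R) : PDO d := mono f 0

/-- The power `∂^i`, `i ∈ ℤ`. -/
def partialPow (i : ℤ) : PDO d := mono 1 i

instance : One (PDO d) := ⟨const 1⟩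

/-- The product given by the generalized Leibniz rule
`(a ∂^i)(b ∂^j) = ∑_{m ≥ 0} binom(i, m) a b^{(m)} ∂^{i + j - m}`. All sums are finite. -/
noncomputable instance : Mul (PDO d) := ⟨fun A B =>
  ⟨fun n => ∑ᶠ p : ℤ × ℕ,
      Ring.choose p.1 p.2 • (A.coeff p.1 * (⇑d)^[p.2] (B.coeff (n - p.1 + (p.2 : ℤ)))), by
    obtain ⟨a, ha⟩ := A.bdd
    obtain ⟨b, hb⟩ := B.bdd
    refine ⟨a + b, fun n hn => ?_⟩
    refine finsum_eq_zero_of_forall_eq_zero fun p => ?_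
    by_cases h : a < p.1
    · rw [ha _ h, zero_mul, smul_zero]
    · rw [hb (n - p.1 + (p.2 : ℤ)) (by omega), iterate_map_zero, mul_zero, smul_zero]⟩⟩

/-- Natural powers. -/
noncomputable def npow (A : PDO d) : ℕ → PDO d
  | 0 => 1
  | n + 1 => A * npow A n

noncomputable instance : Pow (PDO d) ℕ := ⟨npow⟩

/-- The commutator `[A, B]`. -/
noncomputable def comm (A B : PDO d) : PDO d := A * B - B * A

/-- The differential part `A_+`. -/
def posPart (A : PDO d) : PDO d :=
  ⟨fun n => if 0 ≤ n then A.coeff n else 0, by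
    obtain ⟨a, ha⟩ := A.bdd
    exact ⟨a, fun n hn => by rw [ha n hn, ite_self]⟩⟩

/-- The integral part `A_-`. -/
def negPart (A : PDO d) : PDO d :=
  ⟨fun n => if n < 0 then A.coeff n else 0, 0, fun _ hn => if_neg (not_lt.2 hn.le)⟩

/-- A derivation of `R`, applied to the coefficients of an operator. -/
def map (δ : Derivation ℚ R R) (A : PDO d) : PDO d :=
  ⟨fun n => δ (A.coeff n), by
    obtain ⟨a, ha⟩ := A.bdd
    exact ⟨a, fun n hn => by rw [ha n hn, map_zero]⟩⟩

/-- The action `A_+(f) = ∑_{i ≥ 0} a_i f^{(i)}` of the differential part on a function. -/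
noncomputable def act (A : PDO d) (f : R) : R :=
  ∑ᶠ i : ℕ, A.coeff i * (⇑d)^[i] f

/-- The action `(A_+)^*(f) = ∑_{i ≥ 0} (-∂)^i (a_i f)` of the conjugate of the differential
part on a function. -/
noncomputable def adjAct (A : PDO d) (f : R) : R :=
  ∑ᶠ i : ℕ, (-1) ^ i * (⇑d)^[i] (A.coeff i * f)

end PDO

/-- An algebra of functions of the times `t_1 = x, t_2, t_3, …`: a topological algebra with
commuting continuous derivations `∂/∂t_n`, in which the formal sums `∑_l t_l a_l` converge.
(Examples: formal power series in the `t_l`, possibly with further parameters.) -/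
structure TimeAlgebra (R : Type*) [CommRing R] [Algebra ℚ R] [TopologicalSpace R] where
  /-- the time `t_n` -/
  t : ℕ+ → R
  /-- the derivation `∂/∂t_n` -/
  D : ℕ+ → Derivation ℚ R R
  D_comm : ∀ m n f, D m (D n f) = D n (D m f)
  D_t : ∀ m n, D m (t n) = if m = n then 1 else 0
  D_continuous : ∀ n, Continuous (D n)
  summable_t : ∀ a : ℕ+ → R, Summable fun l => t l * a l

namespace TimeAlgebra

variable {R : Type*} [CommRing R] [Algebra ℚ R] [TopologicalSpace R]

/-- `∂ = ∂/∂x` with `x = t_1`. -/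
def dx (τ : TimeAlgebra R) : Derivation ℚ R R := τ.D 1

/-- The integral part `(M L^k)_-`, where `L = S ∂ S^{-1}` and `M = S M⁽⁰⁾ S^{-1}` is the
Orlov-Schulman operator, `M⁽⁰⁾ = ∑_{l ≥ 1} l t_l ∂^{l-1}` (an operator of infinite order: the sum
over `l` is taken in each coefficient). `S'` stands for `S^{-1}`. -/
noncomputable def orlovNeg (τ : TimeAlgebra R) (S S' L : PDO τ.dx) (k : ℕ) : PDO τ.dx :=
  ⟨fun n => if n < 0 then
      ∑' l : ℕ+, (S * PDO.mono ((l : ℕ) • τ.t l) ((l : ℤ) - 1) * S' * L ^ k).coeff n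
    else 0, 0, fun _ hn => if_neg (not_lt.2 hn.le)⟩

/-- The time derivative `∂A/∂t_{k-1}`, with the convention that there is no time flow
(`∂A/∂t_{k-1} = 0`) for `k = 0, 1`. -/
def prevFlow (τ : TimeAlgebra R) (k : ℕ) (A : PDO τ.dx) : PDO τ.dx :=
  if h : 2 ≤ k then A.map (τ.D ⟨k - 1, by omega⟩) else 0

end TimeAlgebra

section cKP

variable {R : Type*} [CommRing R] [Algebra ℚ R]

/-- The operator `∂ + q ∂⁻¹ r`. -/
noncomputable def laxOp (d : Derivation ℚ R R) (q r : R) : PDO d :=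
  PDO.partialPow 1 + PDO.const q * PDO.partialPow (-1) * PDO.const r

/-- `T_I(r) = r⁻¹ ∂⁻¹ r`. -/
noncomputable def gaugeI (d : Derivation ℚ R R) (r : Rˣ) : PDO d :=
  PDO.const (↑r⁻¹ : R) * PDO.partialPow (-1) * PDO.const (r : R)

/-- `T_I(r)⁻¹ = r⁻¹ ∂ r`. -/
noncomputable def gaugeIInv (d : Derivation ℚ R R) (r : Rˣ) : PDO d :=
  PDO.const (↑r⁻¹ : R) * PDO.partialPow 1 * PDO.const (r : R)

/-- A choice of the functions `Q j = L^j(q)` and `P i = (L^*)^i(r)` for `L = ∂ + q ∂⁻¹ r`, that is,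
of the integrals `J i j = ∂⁻¹(P i · Q j)`, where
`L(f) = f_x + q ∂⁻¹(r f)` and `L^*(f) = - f_x - r ∂⁻¹(q f)`.
The integration constants obey integration by parts (`∂⁻¹ ∂ = id`): since
`P i · Q (j+1) - P (i+1) · Q j = ∂ (P i · Q j + J i 0 · J 0 j)`, one has `J_sub`. -/
structure LaxOrbit (d : Derivation ℚ R R) (q r : R) where
  Q : ℕ → R
  P : ℕ → R
  J : ℕ → ℕ → R
  Q_zero : Q 0 = q
  P_zero : P 0 = r
  d_J : ∀ i j, d (J i j) = P i * Q j
  Q_succ : ∀ j, Q (j + 1) = d (Q j) + q * J 0 j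
  P_succ : ∀ i, P (i + 1) = - d (P i) - r * J i 0
  J_sub : ∀ i j, J i (j + 1) - J (i + 1) j = P i * Q j + J i 0 * J 0 j

/-- The operator `X_n^{(1)} = ∑_{j=0}^{n-1} (j - (n-1)/2) L^{n-1-j}(q) ∂⁻¹ (L^*)^j(r)`
(so `X_0^{(1)} = 0`). -/
noncomputable def LaxOrbit.ghost {d : Derivation ℚ R R} {q r : R} (O : LaxOrbit d q r) (n : ℕ) :
    PDO d :=
  ∑ j ∈ Finset.range n,
    PDO.const (((j : ℚ) - ((n : ℚ) - 1) / 2) • O.Q (n - 1 - j)) * PDO.partialPow (-1) *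
      PDO.const (O.P j)

theorem deriv_unit_inv (d : Derivation ℚ R R) (r : Rˣ) :
    d (↑r⁻¹ : R) = - ((↑r⁻¹ : R) * ↑r⁻¹ * d (r : R)) := by
  have h : d ((r : R) * ↑r⁻¹) = 0 := by rw [Units.mul_inv]; exact d.map_one_eq_zero
  rw [Derivation.leibniz, smul_eq_mul, smul_eq_mul] at h
  have h2 : (↑r⁻¹ : R) * r = 1 := Units.inv_mul r
  linear_combination (↑r⁻¹ : R) * h - d (↑r⁻¹ : R) * h2

theorem LaxOrbit.gauge_aux {d : Derivation ℚ R R} {q : R} {r : Rˣ} (O : LaxOrbit d q (r : R)) :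
    ((↑r⁻¹ : R) * O.P 1 = -((↑r⁻¹ : R) * d (r : R)) - O.J 0 0) ∧
    ∀ i, (↑r⁻¹ : R) * O.P (i + 2) = -d ((↑r⁻¹ : R) * O.P (i + 1)) -
      (↑r⁻¹ : R) * d (r : R) * ((↑r⁻¹ : R) * O.P (i + 1)) - O.J (i + 1) 0 := by
  have h2 : (↑r⁻¹ : R) * r = 1 := Units.inv_mul r
  refine ⟨?_, fun i => ?_⟩
  · have h := O.P_succ 0
    rw [O.P_zero] at h
    rw [h]
    linear_combination (- O.J 0 0) * h2
  · rw [O.P_succ (i + 1)]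
    simp only [Derivation.leibniz, smul_eq_mul, deriv_unit_inv]
    linear_combination (- O.J (i + 1) 0) * h2

/-- The functions attached to the transformed operator `L̃ = T L T⁻¹ = ∂ + q̃ ∂⁻¹ r̃`, `T = T_I(r)`,
with `q̃ = r⁻¹` and `r̃ = - r ∂(r⁻¹ L^*(r))`: one has `L̃^{j+1}(q̃) = T(L^j(q)) = r⁻¹ ∂⁻¹(r L^j(q))`
and `(L̃^*)^i(r̃) = (T^*)⁻¹((L^*)^{i+1}(r)) = - r ∂(r⁻¹ (L^*)^{i+1}(r))`,
with the integrals chosen for `L`. -/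
def LaxOrbit.gauge {d : Derivation ℚ R R} {q : R} {r : Rˣ} (O : LaxOrbit d q (r : R)) :
    LaxOrbit d (↑r⁻¹ : R) (-((r : R) * d ((↑r⁻¹ : R) * O.P 1))) where
  Q
    | 0 => (↑r⁻¹ : R)
    | j + 1 => (↑r⁻¹ : R) * O.J 0 j
  P i := -((r : R) * d ((↑r⁻¹ : R) * O.P (i + 1)))
  J
    | i, 0 => -((↑r⁻¹ : R) * O.P (i + 1))
    | i, j + 1 => O.J (i + 1) j - (↑r⁻¹ : R) * O.P (i + 1) * O.J 0 j
  Q_zero := rfl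
  P_zero := rfl
  d_J := by
    have h2 : (↑r⁻¹ : R) * r = 1 := Units.inv_mul r
    rintro i (_ | j)
    · simp only [map_neg]
      linear_combination d ((↑r⁻¹ : R) * O.P (i + 1)) * h2
    · simp only [map_sub]
      rw [Derivation.leibniz d ((↑r⁻¹ : R) * O.P (i + 1)), O.d_J, O.d_J, O.P_zero]
      simp only [smul_eq_mul]
      linear_combination (d ((↑r⁻¹ : R) * O.P (i + 1)) * O.J 0 j - O.P (i + 1) * O.Q j) * h2
  Q_succ := by
    have h2 : (↑r⁻¹ : R) * r = 1 := Units.inv_mul r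
    have hP := O.P_succ 0
    rw [O.P_zero] at hP
    rintro (_ | j)
    · simp only [deriv_unit_inv, zero_add, hP]
      linear_combination (- (↑r⁻¹ : R) * O.J 0 0) * h2
    · have hJ := O.J_sub 0 j
      rw [O.P_zero] at hJ
      simp only [Derivation.leibniz, smul_eq_mul, O.d_J, O.P_zero, deriv_unit_inv, zero_add, hP]
      linear_combination (↑r⁻¹ : R) * hJ - (↑r⁻¹ : R) * O.J 0 0 * O.J 0 j * h2
  P_succ := by
    have h2 : (↑r⁻¹ : R) * r = 1 := Units.inv_mul r
    intro i
    obtain ⟨h0, h1⟩ := O.gauge_aux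
    have e0 := congrArg d h0
    have e1 := congrArg d (h1 i)
    simp only [map_sub, map_neg, O.d_J, O.P_zero, O.Q_zero] at e0 e1
    rw [Derivation.leibniz d ((↑r⁻¹ : R) * d (r : R))] at e1
    rw [e0, map_neg, neg_neg, Derivation.leibniz d (r : R)]
    simp only [smul_eq_mul] at e1 ⊢
    linear_combination (- (r : R)) * e1 +
      (d (r : R) * d ((↑r⁻¹ : R) * O.P (i + 1)) - r * q * O.P (i + 1)) * h2
  J_sub := by
    have h2 : (↑r⁻¹ : R) * r = 1 := Units.inv_mul r
    obtain ⟨h0, h1⟩ := O.gauge_aux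
    rintro i (_ | j)
    · have e := h1 i
      simp only [zero_add]
      linear_combination e + d ((↑r⁻¹ : R) * O.P (i + 1)) * h2 -
        (↑r⁻¹ : R) * O.P (i + 1) * h0
    · have e := h1 i
      have e2 := O.J_sub 0 j
      have e3 := O.J_sub (i + 1) j
      rw [O.P_zero] at e2
      simp only [zero_add] at e2 ⊢
      linear_combination e3 + O.J 0 j * e - (↑r⁻¹ : R) * O.P (i + 1) * e2 -
        (↑r⁻¹ : R) * O.P (i + 1) * O.J 0 j * h0 +
        (d ((↑r⁻¹ : R) * O.P (i + 1)) * O.J 0 j - O.P (i + 1) * O.Q j) * h2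

end cKP

/-- `(q, r)` is a solution of the cKP hierarchy with `m = 1`: `L = ∂ + q ∂⁻¹ r` satisfies
`∂L/∂t_n = [B_n, L]`, `B_n = (L^n)_+`, while `∂q/∂t_n = B_n(q)` and `∂r/∂t_n = -B_n^*(r)`. -/
structure IsCKP {R : Type*} [CommRing R] [Algebra ℚ R] [TopologicalSpace R]
    (τ : TimeAlgebra R) (q r : R) : Prop where
  lax : ∀ n : ℕ+, (laxOp τ.dx q r).map (τ.D n) =
    PDO.comm (PDO.posPart (laxOp τ.dx q r ^ (n : ℕ))) (laxOp τ.dx q r)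
  eigen : ∀ n : ℕ+, τ.D n q = PDO.act (PDO.posPart (laxOp τ.dx q r ^ (n : ℕ))) q
  adjEigen : ∀ n : ℕ+, τ.D n r = - PDO.adjAct (PDO.posPart (laxOp τ.dx q r ^ (n : ℕ))) r

/-- `W = 1 + ∑_{j ≥ 1} w_j ∂^{-j}`, with inverse `W'`, is a dressing operator of `L`:
`L = W ∂ W⁻¹` and `∂W/∂t_n = -(L^n)_- W`. -/
structure IsDressing {R : Type*} [CommRing R] [Algebra ℚ R] [TopologicalSpace R]
    (τ : TimeAlgebra R) (L W W' : PDO τ.dx) : Prop where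
  coeff_zero : W.coeff 0 = 1
  coeff_pos : ∀ n : ℤ, 0 < n → W.coeff n = 0
  mul_inv : W * W' = 1
  inv_mul : W' * W = 1
  dressing : L = W * PDO.partialPow 1 * W'
  sato : ∀ n : ℕ+, W.map (τ.D n) = -(PDO.negPart (L ^ (n : ℕ))) * W

/-! Write `n = k - 1`, `N = (M L^k)_-`, and put tildes on the transformed objects. Differentiating
`L̃ = T L T⁻¹` along the flow gives `[(δT)T⁻¹ + T(-N + X_n)T⁻¹, L̃]`. Each piece is the expected
operator up to some `r⁻¹ ∂⁻¹ f`: `(δT)T⁻¹ = -r⁻¹ ∂⁻¹ φ` with `φ = r ∂(r⁻¹ δr)` (`map_gaugeI`); `T N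
T⁻¹ = Ñ + r⁻¹ ∂⁻¹ β` (`exists_gauge_orlovNeg`); `T X_n T⁻¹ = X̃_n + (L̃^n)_- - r⁻¹ ∂⁻¹ ν`
(`gauge_ghost`). In the last one, `T` shifts the index of the ghost sum by one, and since the
weights grow by one per step the shift leaves an extra copy of `(L̃^n)_-`. Its commutator with `L̃`
is `-∂L̃/∂t_n` (`map_gauge_laxOp`), which is the additional term of the theorem.

It remains to see that `φ + β + ν = 0`. The flow is given on `L` only, so `δr` must be extracted
from it. The functional `residueForm r` kills differential operators and all `a ∂⁻¹ r`, and sends `q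
∂⁻¹ b` to `-q r · r ∂(r⁻¹ b)`. Applied to `δL = [-N + X_n, L]` it gives `-q r φ` on the left. On the
right, `[N, L]` contributes through `β` and `L^k` (from `[L, M] = 1`), and `[X_n, L]` through `ν`
and `L^{n+1}` (`residueForm_comm_ghost`). The powers of `L` cancel, and `q r` can be divided out
(`gauge_generator`). -/

/-! ### The ring of pseudo-differential operators. -/

namespace PDO

variable {R : Type*} [CommRing R] [Algebra ℚ R] {d : Derivation ℚ R R}

/-- `A` has order at most `a`. -/
def OrdLE (A : PDO d) (a : ℤ) : Prop := ∀ n, a < n → A.coeff n = 0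

theorem OrdLE.mono {A : PDO d} {a b : ℤ} (h : OrdLE A a) (hab : a ≤ b) : OrdLE A b :=
  fun n hn => h n (lt_of_le_of_lt hab hn)

theorem exists_ordLE (A : PDO d) : ∃ a, OrdLE A a := A.bdd

@[simp] theorem zero_coeff (n : ℤ) : (0 : PDO d).coeff n = 0 := rfl
@[simp] theorem add_coeff (A B : PDO d) (n : ℤ) : (A + B).coeff n = A.coeff n + B.coeff n := rfl
@[simp] theorem sub_coeff (A B : PDO d) (n : ℤ) : (A - B).coeff n = A.coeff n - B.coeff n := rfl
@[simp] theorem neg_coeff (A : PDO d) (n : ℤ) : (-A).coeff n = -A.coeff n := rfl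
theorem mono_coeff (f : R) (i n : ℤ) : (mono f i : PDO d).coeff n = if n = i then f else 0 := rfl

/-- Taking a coefficient, as an additive map. -/
def coeffHom (n : ℤ) : PDO d →+ R where
  toFun A := A.coeff n
  map_zero' := rfl
  map_add' _ _ := rfl

theorem sum_coeff {ι : Type*} (s : Finset ι) (A : ι → PDO d) (n : ℤ) :
    (∑ j ∈ s, A j).coeff n = ∑ j ∈ s, (A j).coeff n := map_sum (coeffHom n) A s

theorem ordLE_mono (f : R) (i : ℤ) : OrdLE (mono f i : PDO d) i := fun _ hn => if_neg (ne_of_gt hn)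

theorem OrdLE.add {A B : PDO d} {a : ℤ} (hA : OrdLE A a) (hB : OrdLE B a) : OrdLE (A + B) a :=
  fun n hn => by rw [add_coeff, hA n hn, hB n hn, add_zero]

theorem OrdLE.neg {A : PDO d} {a : ℤ} (hA : OrdLE A a) : OrdLE (-A) a :=
  fun n hn => by rw [neg_coeff, hA n hn, neg_zero]

theorem OrdLE.sub {A B : PDO d} {a : ℤ} (hA : OrdLE A a) (hB : OrdLE B a) : OrdLE (A - B) a :=
  fun n hn => by rw [sub_coeff, hA n hn, hB n hn, sub_zero]

theorem mul_coeff (A B : PDO d) (n : ℤ) : (A * B).coeff n = ∑ᶠ p : ℤ × ℕ,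
    Ring.choose p.1 p.2 • (A.coeff p.1 * (⇑d)^[p.2] (B.coeff (n - p.1 + (p.2 : ℤ)))) := rfl

/-- The coefficient `∑_{m < K} binom(p, m) B_{n - p + m}^{(m)}` of `∂^p B`, truncated at `K`. -/
noncomputable def row (B : PDO d) (K : ℕ) (p n : ℤ) : R :=
  ∑ m ∈ Finset.range K, Ring.choose p m • (⇑d)^[m] (B.coeff (n - p + (m : ℤ)))

/-- The order bounds confine the support to a finite box. The box may be enlarged freely, so that
different products can be compared over one index set. -/
theorem mul_coeff_eq {A B : PDO d} {a b : ℤ} (hA : OrdLE A a) (hB : OrdLE B b) (n : ℤ)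
    {lo hi : ℤ} {K : ℕ} (hlo : lo ≤ n - b) (hhi : a ≤ hi) (hK : a + b - n < K) :
    (A * B).coeff n = ∑ p ∈ Finset.Icc lo hi, A.coeff p * row B K p n := by
  rw [mul_coeff, finsum_eq_sum_of_support_subset (s := Finset.Icc lo hi ×ˢ Finset.range K),
    Finset.sum_product]
  · refine Finset.sum_congr rfl fun p _ => ?_
    rw [row, Finset.mul_sum]
    exact Finset.sum_congr rfl fun m _ => (mul_smul_comm _ _ _).symm
  · rintro ⟨p, m⟩ hpm
    simp only [Finset.coe_product, Set.mem_prod, Finset.coe_Icc, Set.mem_Icc, Finset.coe_range,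
      Set.mem_Iio]
    have hp : p ≤ a := by
      by_contra h
      exact hpm (by simp only [hA p (not_le.1 h), zero_mul, smul_zero])
    have hm : n - p + (m : ℤ) ≤ b := by
      by_contra h
      exact hpm (by simp only [hB _ (not_le.1 h), iterate_map_zero, mul_zero, smul_zero])
    refine ⟨⟨by omega, by omega⟩, by omega⟩

theorem OrdLE.mul {A B : PDO d} {a b : ℤ} (hA : OrdLE A a) (hB : OrdLE B b) :
    OrdLE (A * B) (a + b) := by
  intro n hn
  rw [mul_coeff_eq hA hB n le_rfl le_rfl (by omega :
    a + b - n < ((a + b - n).toNat + 1 : ℕ)), Finset.Icc_eq_empty (by omega), Finset.sum_empty]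

theorem row_add (B C : PDO d) (K : ℕ) (p n : ℤ) : row (B + C) K p n = row B K p n + row C K p n := by
  simp only [row, add_coeff, iterate_map_add, smul_add, Finset.sum_add_distrib]

theorem exists_nat_gt (z : ℤ) : ∃ K : ℕ, z < K := ⟨z.toNat + 1, by omega⟩

protected theorem mul_add' (A B C : PDO d) : A * (B + C) = A * B + A * C := by
  obtain ⟨a, hA⟩ := A.exists_ordLE
  obtain ⟨b, hB⟩ := B.exists_ordLE
  obtain ⟨c, hC⟩ := C.exists_ordLE
  have hB' := hB.mono (le_max_left b c)
  have hC' := hC.mono (le_max_right b c)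
  ext n
  obtain ⟨K, hK⟩ := exists_nat_gt (a + max b c - n)
  rw [add_coeff, mul_coeff_eq hA (hB'.add hC') n le_rfl le_rfl hK,
    mul_coeff_eq hA hB' n le_rfl le_rfl hK, mul_coeff_eq hA hC' n le_rfl le_rfl hK,
    ← Finset.sum_add_distrib]
  exact Finset.sum_congr rfl fun p _ => by rw [row_add, mul_add]

protected theorem add_mul' (A B C : PDO d) : (A + B) * C = A * C + B * C := by
  obtain ⟨a, hA⟩ := A.exists_ordLE
  obtain ⟨b, hB⟩ := B.exists_ordLE
  obtain ⟨c, hC⟩ := C.exists_ordLE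
  have hA' := hA.mono (le_max_left a b)
  have hB' := hB.mono (le_max_right a b)
  ext n
  obtain ⟨K, hK⟩ := exists_nat_gt (max a b + c - n)
  rw [add_coeff, mul_coeff_eq (hA'.add hB') hC n le_rfl le_rfl hK,
    mul_coeff_eq hA' hC n le_rfl le_rfl hK, mul_coeff_eq hB' hC n le_rfl le_rfl hK,
    ← Finset.sum_add_distrib]
  exact Finset.sum_congr rfl fun p _ => by rw [add_coeff, add_mul]

theorem const_mul_coeff (f : R) (B : PDO d) (n : ℤ) : (const f * B).coeff n = f * B.coeff n := by
  rw [mul_coeff, finsum_eq_single _ (0, 0)]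
  · simp [const, mono_coeff]
  · rintro ⟨p, m⟩ h
    by_cases hp : p = 0
    · subst hp
      have hm : 0 < m := Nat.pos_of_ne_zero fun h0 => h (by rw [h0])
      simp [Ring.choose_zero_pos ℤ hm]
    · simp [const, mono_coeff, hp]

theorem iterate_one {m : ℕ} (hm : m ≠ 0) : (⇑d)^[m] (1 : R) = 0 := by
  obtain ⟨k, rfl⟩ := Nat.exists_eq_succ_of_ne_zero hm
  rw [Function.iterate_succ_apply, Derivation.map_one_eq_zero, iterate_map_zero]

theorem mul_partialPow_coeff (A : PDO d) (j n : ℤ) :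
    (A * partialPow j).coeff n = A.coeff (n - j) := by
  rw [mul_coeff, finsum_eq_single _ (n - j, 0)]
  · simp [partialPow, mono_coeff]
  · rintro ⟨p, m⟩ h
    simp only [partialPow, mono_coeff]
    split_ifs with hj
    · have hm : m ≠ 0 := by
        rintro rfl
        exact h (by simp only [Prod.mk.injEq, and_true]; push_cast at hj; omega)
      rw [iterate_one hm, mul_zero, smul_zero]
    · rw [iterate_map_zero, mul_zero, smul_zero]

theorem ordLE_partialPow (i : ℤ) : OrdLE (partialPow i : PDO d) i := ordLE_mono 1 i

theorem choose_one_of_two_le (m : ℕ) : Ring.choose (1 : ℤ) (m + 2) = 0 := by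
  rw [← Nat.cast_one, Ring.choose_natCast, Nat.choose_eq_zero_of_lt (by omega), Nat.cast_zero]

theorem partial_mul_coeff (B : PDO d) (n : ℤ) :
    (partialPow 1 * B).coeff n = d (B.coeff n) + B.coeff (n - 1) := by
  obtain ⟨b, hB⟩ := B.exists_ordLE
  obtain ⟨K, hK⟩ := exists_nat_gt (1 + b - n)
  rw [mul_coeff_eq (ordLE_partialPow 1) hB n (lo := min 1 (n - b)) (hi := 1) (K := K + 2)
    (min_le_right _ _) le_rfl (by push_cast; omega), Finset.sum_eq_single 1]
  · rw [row, Finset.sum_range_succ', Finset.sum_range_succ']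
    simp [choose_one_of_two_le, partialPow, mono_coeff]
  · intro p _ hp
    simp [partialPow, mono_coeff, hp]
  · intro h
    exact absurd (Finset.mem_Icc.2 ⟨min_le_left _ _, le_rfl⟩) h

theorem const_mul_mono (f g : R) (i : ℤ) : (const f * mono g i : PDO d) = mono (f * g) i := by
  ext n
  rw [const_mul_coeff, mono_coeff, mono_coeff, mul_ite, mul_zero]

theorem const_mul_partialPow (f : R) (i : ℤ) : (const f * partialPow i : PDO d) = mono f i := by
  rw [partialPow, const_mul_mono, mul_one]

theorem mono_mul_partialPow (f : R) (i j : ℤ) :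
    (mono f i * partialPow j : PDO d) = mono f (i + j) := by
  ext n
  rw [mul_partialPow_coeff, mono_coeff, mono_coeff]
  simp only [sub_eq_iff_eq_add]

theorem partialPow_mul_partialPow (i j : ℤ) :
    (partialPow i * partialPow j : PDO d) = partialPow (i + j) := mono_mul_partialPow 1 i j

protected theorem one_mul' (A : PDO d) : 1 * A = A := by
  ext n
  exact (const_mul_coeff 1 A n).trans (one_mul _)

protected theorem mul_one' (A : PDO d) : A * 1 = A := by
  ext n
  have h := mul_partialPow_coeff A 0 n
  rw [sub_zero] at h
  exact h

/-- Pascal's rule for an integer upper index. `hK` makes the last term of the truncated sum vanish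
after differentiation, so that the truncation does no harm. -/
theorem row_succ {B : PDO d} {b : ℤ} (hB : OrdLE B b) (K : ℕ) (p n : ℤ) (hK : b - n + p < K) :
    row B (K + 1) (p + 1) n = d (row B (K + 1) p n) + row B (K + 1) p (n - 1) := by
  have h : ∀ m, Ring.choose (p + 1) (m + 1) = Ring.choose p m + Ring.choose p (m + 1) :=
    fun m => Ring.choose_succ_succ p m
  have e : ∀ m : ℕ, n - (p + 1) + ((m + 1 : ℕ) : ℤ) = n - p + m := fun m => by push_cast; ring
  have e' : ∀ m : ℕ, n - 1 - p + ((m + 1 : ℕ) : ℤ) = n - p + m := fun m => by push_cast; ring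
  have e0 : n - (p + 1) + ((0 : ℕ) : ℤ) = n - 1 - p + ((0 : ℕ) : ℤ) := by ring
  have hd : d (row B (K + 1) p n) =
      ∑ m ∈ Finset.range K, Ring.choose p m • (⇑d)^[m + 1] (B.coeff (n - p + m)) := by
    rw [row, map_sum, Finset.sum_range_succ, map_zsmul, ← Function.iterate_succ_apply' d]
    have : (⇑d)^[K + 1] (B.coeff (n - p + K)) = d ((⇑d)^[K] (B.coeff (n - p + K))) :=
      Function.iterate_succ_apply' _ _ _
    by_cases hlt : b < n - p + K
    · rw [hB _ hlt, iterate_map_zero, smul_zero, add_zero]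
      exact Finset.sum_congr rfl fun m _ => by rw [map_zsmul, ← Function.iterate_succ_apply' d]
    · exfalso
      omega
  rw [hd, row, row, Finset.sum_range_succ', Finset.sum_range_succ', e0, ← add_assoc,
    Ring.choose_zero_right, Ring.choose_zero_right, ← Finset.sum_add_distrib]
  congr 1
  exact Finset.sum_congr rfl fun m _ => by rw [h, e, e', add_smul]

/-- The case of associativity that needs the binomial coefficients: `row_succ` and the Leibniz rule
match the two sides row by row. Powers of `∂`, functions, monomials and general operators follow in
turn. -/
theorem partial_mul_assoc (B C : PDO d) : partialPow 1 * B * C = partialPow 1 * (B * C) := by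
  obtain ⟨b, hB⟩ := B.exists_ordLE
  obtain ⟨c, hC⟩ := C.exists_ordLE
  ext n
  rw [partial_mul_coeff]
  obtain ⟨K, hK⟩ := exists_nat_gt (b + c - n + 4)
  have hd : OrdLE (partialPow 1 * B) (b + 1) := by
    simpa [add_comm] using (ordLE_partialPow 1).mul hB
  rw [mul_coeff_eq hd hC n (lo := n - c - 1) (hi := b + 1) (K := K + 1)
      (by omega) (by omega) (by push_cast; omega),
    mul_coeff_eq hB hC n (lo := n - c - 2) (hi := b + 1) (K := K + 1)
      (by omega) (by omega) (by push_cast; omega),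
    mul_coeff_eq hB hC (n - 1) (lo := n - c - 2) (hi := b + 1) (K := K + 1)
      (by omega) (by omega) (by push_cast; omega), map_sum]
  have shift : ∑ p ∈ Finset.Icc (n - c - 1) (b + 1), B.coeff (p - 1) * row C (K + 1) p n =
      ∑ p ∈ Finset.Icc (n - c - 2) b, B.coeff p * row C (K + 1) (p + 1) n := by
    refine Finset.sum_nbij' (fun p => p - 1) (fun p => p + 1) ?_ ?_ ?_ ?_ ?_
    · intro p hp; rw [Finset.mem_Icc] at hp ⊢; omega
    · intro p hp; rw [Finset.mem_Icc] at hp ⊢; omega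
    · intro p _; ring
    · intro p _; ring
    · intro p _; rw [sub_add_cancel]
  have ext1 : ∑ p ∈ Finset.Icc (n - c - 2) b, B.coeff p * row C (K + 1) (p + 1) n =
      ∑ p ∈ Finset.Icc (n - c - 2) (b + 1), B.coeff p * row C (K + 1) (p + 1) n := by
    refine Finset.sum_subset (Finset.Icc_subset_Icc le_rfl (by omega)) fun p _ hp' => ?_
    rw [hB p (by rw [Finset.mem_Icc] at *; omega), zero_mul]
  have ext2 : ∑ p ∈ Finset.Icc (n - c - 1) (b + 1), d (B.coeff p) * row C (K + 1) p n =
      ∑ p ∈ Finset.Icc (n - c - 2) (b + 1), d (B.coeff p) * row C (K + 1) p n := by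
    refine Finset.sum_subset (Finset.Icc_subset_Icc (by omega) le_rfl) fun p hp hp' => ?_
    rw [row, Finset.sum_eq_zero, mul_zero]
    intro m _
    rw [hC _ (by rw [Finset.mem_Icc] at *; omega), iterate_map_zero, smul_zero]
  simp only [partial_mul_coeff, add_mul, Finset.sum_add_distrib]
  rw [shift, ext1, ext2, ← Finset.sum_add_distrib, ← Finset.sum_add_distrib]
  refine Finset.sum_congr rfl fun p hp => ?_
  rw [row_succ hC K p n (by rw [Finset.mem_Icc] at hp; omega), Derivation.leibniz, smul_eq_mul,
    smul_eq_mul]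
  ring

/-- The coefficients of `∂A` are `a_n' + a_{n-1}`, so those of `A` are determined from the top
downwards. Cancelling `∂` carries associativity over to negative powers. -/
theorem partial_mul_injective {A B : PDO d} (h : partialPow 1 * A = partialPow 1 * B) : A = B := by
  have key : ∀ n, d (A.coeff n - B.coeff n) + (A.coeff (n - 1) - B.coeff (n - 1)) = 0 := fun n => by
    have := congrArg (fun X => PDO.coeff X n) h
    simp only [partial_mul_coeff] at this
    rw [map_sub]
    linear_combination this
  obtain ⟨a, hA⟩ := A.exists_ordLE
  obtain ⟨b, hB⟩ := B.exists_ordLE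
  have main : ∀ m : ℕ, A.coeff (max a b + 1 - m) - B.coeff (max a b + 1 - m) = 0 := by
    intro m
    induction m with
    | zero => rw [hA _ (by push_cast; omega), hB _ (by push_cast; omega), sub_zero]
    | succ m ih =>
      have := key (max a b + 1 - m)
      rw [ih, map_zero, zero_add] at this
      rw [← this]
      push_cast
      ring_nf
  ext n
  by_cases hn : max a b < n
  · rw [hA _ (by omega), hB _ (by omega)]
  · have := main (max a b + 1 - n).toNat
    rw [Int.toNat_of_nonneg (by omega), sub_sub_cancel] at this
    exact sub_eq_zero.1 this

theorem partialPow_mul_assoc (i : ℤ) (B C : PDO d) :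
    partialPow i * B * C = partialPow i * (B * C) := by
  have step : ∀ (j : ℤ) (X : PDO d), partialPow 1 * (partialPow j * X) = partialPow (j + 1) * X :=
    fun j X => by rw [← partial_mul_assoc, partialPow_mul_partialPow, add_comm]
  induction i using Int.induction_on with
  | zero =>
    change (1 : PDO d) * B * C = 1 * (B * C)
    rw [PDO.one_mul', PDO.one_mul']
  | succ i ih => rw [← step, partial_mul_assoc, ih, step]
  | pred i ih =>
    apply partial_mul_injective
    rw [← partial_mul_assoc, step, step, sub_add_cancel, ih]

theorem const_mul_assoc (f : R) (B C : PDO d) : const f * B * C = const f * (B * C) := by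
  obtain ⟨b, hB⟩ := B.exists_ordLE
  obtain ⟨c, hC⟩ := C.exists_ordLE
  ext n
  obtain ⟨K, hK⟩ := exists_nat_gt (b + c - n)
  have h : OrdLE (const f * B) b := by simpa [const] using (ordLE_mono f 0).mul hB
  rw [const_mul_coeff, mul_coeff_eq h hC n le_rfl le_rfl hK, mul_coeff_eq hB hC n le_rfl le_rfl hK,
    Finset.mul_sum]
  exact Finset.sum_congr rfl fun p _ => by rw [const_mul_coeff, mul_assoc]

theorem mono_mul_assoc (f : R) (i : ℤ) (B C : PDO d) : mono f i * B * C = mono f i * (B * C) := by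
  rw [← const_mul_partialPow, const_mul_assoc, const_mul_assoc, partialPow_mul_assoc,
    const_mul_assoc]

noncomputable instance : NonUnitalNonAssocSemiring (PDO d) where
  left_distrib := PDO.mul_add'
  right_distrib := PDO.add_mul'
  zero_mul A := by
    have h := PDO.add_mul' 0 0 A
    rw [add_zero] at h
    exact left_eq_add.1 h
  mul_zero A := by
    have h := PDO.mul_add' A 0 0
    rw [add_zero] at h
    exact left_eq_add.1 h

/-- An operator is a finite sum of monomials up to terms of low order. -/
theorem exists_eq_sum_mono_add (A : PDO d) {a : ℤ} (hA : OrdLE A a) (N : ℤ) :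
    ∃ E : PDO d, OrdLE E (N - 1) ∧ A = ∑ i ∈ Finset.Icc N a, mono (A.coeff i) i + E := by
  refine ⟨A - ∑ i ∈ Finset.Icc N a, mono (A.coeff i) i, fun n hn => ?_, by abel⟩
  simp only [sub_coeff, sum_coeff, mono_coeff]
  rw [Finset.sum_ite_eq]
  split_ifs with h
  · exact sub_self _
  · rw [hA n (by rw [Finset.mem_Icc] at h; omega), sub_zero]

protected theorem mul_assoc' (A B C : PDO d) : A * B * C = A * (B * C) := by
  obtain ⟨a, hA⟩ := A.exists_ordLE
  obtain ⟨b, hB⟩ := B.exists_ordLE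
  obtain ⟨c, hC⟩ := C.exists_ordLE
  ext n
  -- With this cutoff both products of `E`, `B`, `C` have order at most `n - 1` and do not reach the
  -- coefficient `n`.
  obtain ⟨E, hE, hAE⟩ := A.exists_eq_sum_mono_add hA (n - b - c)
  rw [hAE]
  simp only [add_mul, Finset.sum_mul, mono_mul_assoc, add_coeff]
  rw [((hE.mul hB).mul hC) n (by omega), (hE.mul (hB.mul hC)) n (by omega)]

theorem npow_succ' (A : PDO d) (n : ℕ) : npow A (n + 1) = npow A n * A := by
  induction n with
  | zero => exact (PDO.mul_one' A).trans (PDO.one_mul' A).symm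
  | succ n ih =>
    change A * npow A (n + 1) = A * npow A n * A
    rw [ih, PDO.mul_assoc']

noncomputable instance : Ring (PDO d) where
  __ : AddCommGroup (PDO d) := inferInstance
  __ : NonUnitalNonAssocSemiring (PDO d) := inferInstance
  mul_assoc := PDO.mul_assoc'
  one_mul := PDO.one_mul'
  mul_one := PDO.mul_one'
  npow n A := npow A n
  npow_zero _ := rfl
  npow_succ n A := npow_succ' A n

/-! ### Functions and the operators `a ∂⁻¹ b`. -/

theorem const_mul_const (f g : R) : (const f * const g : PDO d) = const (f * g) :=
  const_mul_mono f g 0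

theorem const_zero : (const 0 : PDO d) = 0 := by
  ext n
  simp [const, mono_coeff]

theorem const_add (f g : R) : (const (f + g) : PDO d) = const f + const g := by
  ext n
  simp only [const, mono_coeff, add_coeff]
  split_ifs <;> simp

/-- The embedding of functions, as an additive map. -/
def constHom : R →+ PDO d where
  toFun := const
  map_zero' := const_zero
  map_add' := const_add

theorem const_neg (f : R) : (const (-f) : PDO d) = -const f := map_neg constHom f
theorem const_sum {ι : Type*} (s : Finset ι) (f : ι → R) :
    (const (∑ j ∈ s, f j) : PDO d) = ∑ j ∈ s, const (f j) := map_sum constHom f s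

theorem const_one : (const 1 : PDO d) = 1 := rfl

theorem const_coeff_zero (f : R) : (const f : PDO d).coeff 0 = f := by
  rw [const, mono_coeff, if_pos rfl]

theorem partial_mul_const (f : R) :
    (partialPow 1 * const f : PDO d) = const f * partialPow 1 + const (d f) := by
  ext n
  rw [partial_mul_coeff, add_coeff, mul_partialPow_coeff]
  simp only [const, mono_coeff]
  rw [add_comm]
  split_ifs <;> simp only [map_zero]

theorem partial_mul_integral : (partialPow 1 * partialPow (-1) : PDO d) = 1 :=
  partialPow_mul_partialPow 1 (-1)

theorem integral_mul_partial : (partialPow (-1) * partialPow 1 : PDO d) = 1 :=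
  partialPow_mul_partialPow (-1) 1

theorem partial_mul_integral_mul (A : PDO d) : partialPow 1 * (partialPow (-1) * A) = A := by
  rw [← mul_assoc, partial_mul_integral, one_mul]

theorem integral_mul_partial_mul (A : PDO d) : partialPow (-1) * (partialPow 1 * A) = A := by
  rw [← mul_assoc, integral_mul_partial, one_mul]

theorem const_mul_const_mul (f g : R) (A : PDO d) : const f * (const g * A) = const (f * g) * A := by
  rw [← mul_assoc, const_mul_const]

theorem const_mul_partial (f : R) :
    (const f * partialPow 1 : PDO d) = partialPow 1 * const f - const (d f) := by
  rw [partial_mul_const, add_sub_cancel_right]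

/-- Integration by parts for `∂⁻¹ f ∂`. -/
theorem integral_const_partial (f : R) :
    (partialPow (-1) * const f * partialPow 1 : PDO d) =
      const f - partialPow (-1) * const (d f) := by
  rw [mul_assoc, const_mul_partial, mul_sub, integral_mul_partial_mul]

/-- Follows from `F' = [∂, F]`. It makes a product of operators `a ∂⁻¹ b` a sum of such operators
once the inner product of functions has an antiderivative. -/
theorem integral_const_integral (F : R) :
    (partialPow (-1) * const (d F) * partialPow (-1) : PDO d) =
      const F * partialPow (-1) - partialPow (-1) * const F := by
  have h : (const (d F) : PDO d) = partialPow 1 * const F - const F * partialPow 1 := by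
    rw [partial_mul_const, add_sub_cancel_left]
  rw [h, mul_sub, sub_mul, integral_mul_partial_mul, mul_assoc, mul_assoc, partial_mul_integral,
    mul_one]

/-- The operator `a ∂⁻¹ b`. -/
noncomputable def rankOne (d : Derivation ℚ R R) (a b : R) : PDO d :=
  const a * partialPow (-1) * const b

theorem rankOne_add_left (a a' b : R) :
    rankOne d (a + a') b = rankOne d a b + rankOne d a' b := by
  simp only [rankOne, const_add, add_mul]

theorem rankOne_add_right (a b b' : R) :
    rankOne d a (b + b') = rankOne d a b + rankOne d a b' := by
  simp only [rankOne, const_add, mul_add]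

/-- The map `(a, b) ↦ a ∂⁻¹ b`, as a biadditive map. -/
noncomputable def rankOneHom (d : Derivation ℚ R R) : R →+ R →+ PDO d :=
  AddMonoidHom.mk' (fun a => AddMonoidHom.mk' (rankOne d a) (rankOne_add_right a))
    fun a a' => AddMonoidHom.ext fun b => rankOne_add_left a a' b

theorem rankOneHom_apply (a b : R) : rankOneHom d a b = rankOne d a b := rfl

theorem rankOne_zero_right (a : R) : rankOne d a 0 = 0 := by
  simp [← rankOneHom_apply]
theorem rankOne_neg_right (a b : R) : rankOne d a (-b) = -rankOne d a b := by
  simp [← rankOneHom_apply]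
theorem rankOne_sub_left (a a' b : R) :
    rankOne d (a - a') b = rankOne d a b - rankOne d a' b := by
  simp [← rankOneHom_apply]
theorem rankOne_sub_right (a b b' : R) :
    rankOne d a (b - b') = rankOne d a b - rankOne d a b' := by
  simp [← rankOneHom_apply]
theorem rankOne_sum_left {ι : Type*} (s : Finset ι) (f : ι → R) (b : R) :
    rankOne d (∑ j ∈ s, f j) b = ∑ j ∈ s, rankOne d (f j) b := by
  simp [← rankOneHom_apply]
theorem rankOne_sum_right {ι : Type*} (s : Finset ι) (a : R) (f : ι → R) :
    rankOne d a (∑ j ∈ s, f j) = ∑ j ∈ s, rankOne d a (f j) := by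
  simp [← rankOneHom_apply]
theorem const_mul_rankOne (f a b : R) : const f * rankOne d a b = rankOne d (f * a) b := by
  simp only [rankOne, ← mul_assoc, const_mul_const]

theorem rankOne_mul_const (a b f : R) : rankOne d a b * const f = rankOne d a (b * f) := by
  simp only [rankOne, mul_assoc, const_mul_const]

theorem partial_mul_rankOne (a b : R) :
    partialPow 1 * rankOne d a b = const (a * b) + rankOne d (d a) b := by
  rw [rankOne, ← mul_assoc, ← mul_assoc, partial_mul_const, add_mul, add_mul, rankOne,
    mul_assoc (const a), partial_mul_integral, mul_one, const_mul_const]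

theorem rankOne_mul_partial (a b : R) :
    rankOne d a b * partialPow 1 = const (a * b) - rankOne d a (d b) := by
  rw [rankOne, rankOne, mul_assoc (const a), mul_assoc (const a), integral_const_partial, mul_sub,
    const_mul_const, ← mul_assoc]

theorem rankOne_mul_rankOne {a b a' b' F : R} (h : d F = b * a') :
    rankOne d a b * rankOne d a' b' = rankOne d (a * F) b' - rankOne d a (F * b') := by
  have e : rankOne d a b * rankOne d a' b' =
      const a * (partialPow (-1) * const (d F) * partialPow (-1)) * const b' := by
    rw [h, ← const_mul_const]
    simp only [rankOne, mul_assoc]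
  rw [e, integral_const_integral]
  simp only [rankOne, mul_sub, sub_mul, mul_assoc, ← const_mul_const]

theorem ordLE_const (f : R) : OrdLE (const f : PDO d) 0 := ordLE_mono f 0

theorem ordLE_rankOne (a b : R) : OrdLE (rankOne d a b) (-1) := by
  exact ((ordLE_const a).mul (ordLE_partialPow (-1))).mul (ordLE_const b)

theorem rankOne_eq (a b : R) :
    rankOne d a b = const (a * b) * partialPow (-1) - rankOne d a (d b) * partialPow (-1) := by
  rw [← sub_mul, ← rankOne_mul_partial, mul_assoc, partial_mul_integral, mul_one]

theorem rankOne_coeff_neg_one (a b : R) : (rankOne d a b).coeff (-1) = a * b := by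
  rw [rankOne_eq, sub_coeff, mul_partialPow_coeff, mul_partialPow_coeff,
    ordLE_rankOne a (d b) (-1 - -1) (by norm_num), sub_self, const_coeff_zero, sub_zero]

theorem rankOne_coeff_neg_two (a b : R) : (rankOne d a b).coeff (-2) = -(a * d b) := by
  rw [rankOne_eq, sub_coeff, mul_partialPow_coeff, mul_partialPow_coeff]
  norm_num
  rw [rankOne_coeff_neg_one]
  simp [const, mono_coeff]

/-! ### Differential operators and integral parts. -/

/-- `A` is a differential operator. -/
def IsPos (A : PDO d) : Prop := ∀ n < 0, A.coeff n = 0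

theorem isPos_const (f : R) : IsPos (const f : PDO d) := fun _ hn => if_neg hn.ne

theorem isPos_partial : IsPos (partialPow 1 : PDO d) := fun _ hn => if_neg (by omega)

theorem isPos_posPart (A : PDO d) : IsPos (posPart A) := fun _ hn => if_neg (not_le.2 hn)

theorem isPos_zero : IsPos (0 : PDO d) := fun _ _ => rfl

theorem isPos_one : IsPos (1 : PDO d) := isPos_const 1

theorem IsPos.add {A B : PDO d} (hA : IsPos A) (hB : IsPos B) : IsPos (A + B) :=
  fun n hn => by rw [add_coeff, hA n hn, hB n hn, add_zero]

theorem IsPos.neg {A : PDO d} (hA : IsPos A) : IsPos (-A) :=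
  fun n hn => by rw [neg_coeff, hA n hn, neg_zero]

theorem IsPos.sub {A B : PDO d} (hA : IsPos A) (hB : IsPos B) : IsPos (A - B) :=
  fun n hn => by rw [sub_coeff, hA n hn, hB n hn, sub_zero]

theorem IsPos.sum {ι : Type*} {s : Finset ι} {A : ι → PDO d} (h : ∀ j ∈ s, IsPos (A j)) :
    IsPos (∑ j ∈ s, A j) := fun n hn => by
  rw [sum_coeff]
  exact Finset.sum_eq_zero fun j hj => h j hj n hn

theorem IsPos.mul {A B : PDO d} (hA : IsPos A) (hB : IsPos B) : IsPos (A * B) := by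
  intro n hn
  rw [mul_coeff]
  refine finsum_eq_zero_of_forall_eq_zero fun ⟨p, m⟩ => ?_
  rcases lt_or_ge p 0 with hp | hp
  · rw [hA _ hp, zero_mul, smul_zero]
  · lift p to ℕ using hp
    rcases lt_or_ge p m with hpm | hpm
    · simp only [Ring.choose_natCast, Nat.choose_eq_zero_of_lt hpm, Nat.cast_zero, zero_smul]
    · rw [hB _ (by simp only; omega), iterate_map_zero, mul_zero, smul_zero]

theorem posPart_add_negPart (A : PDO d) : posPart A + negPart A = A := by
  ext n
  simp only [posPart, negPart, add_coeff]
  rcases lt_or_ge n 0 with h | h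
  · rw [if_neg (not_le.2 h), if_pos h, zero_add]
  · rw [if_pos h, if_neg (not_lt.2 h), add_zero]

theorem ordLE_negPart (A : PDO d) : OrdLE (negPart A) (-1) := fun _ hn =>
  if_neg (by omega)

theorem negPart_coeff {A : PDO d} {n : ℤ} (hn : n < 0) : (negPart A).coeff n = A.coeff n := if_pos hn

theorem negPart_eq_of_add {A B C : PDO d} (h : A = B + C) (hB : IsPos B) (hC : OrdLE C (-1)) :
    negPart A = C := by
  ext n
  rcases lt_or_ge n 0 with hn | hn
  · rw [negPart_coeff hn, h, add_coeff, hB n hn, zero_add]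
  · rw [ordLE_negPart A n (by omega), hC n (by omega)]

theorem IsPos.exists_mul_integral {E : PDO d} (hE : IsPos E) :
    ∃ F : PDO d, IsPos F ∧ E * partialPow (-1) = F + const (E.coeff 0) * partialPow (-1) := by
  refine ⟨E * partialPow (-1) - const (E.coeff 0) * partialPow (-1), fun n hn => ?_, by abel⟩
  rw [sub_coeff, mul_partialPow_coeff, const_mul_coeff, partialPow, mono_coeff]
  split_ifs with h
  · rw [h, mul_one, sub_neg_eq_add, neg_add_cancel, sub_self]
  · rw [hE _ (by omega), mul_zero, sub_zero]

theorem IsPos.exists_eq_mul_partial_add {E : PDO d} (hE : IsPos E) :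
    ∃ F : PDO d, IsPos F ∧ E = F * partialPow 1 + const (E.coeff 0) := by
  obtain ⟨F, hF, h⟩ := hE.exists_mul_integral
  refine ⟨F, hF, ?_⟩
  have := congrArg (· * partialPow 1) h
  simpa only [add_mul, mul_assoc, integral_mul_partial, mul_one] using this

/-- Repeated integration by parts: each `∂` absorbed by `∂⁻¹` splits off a function and changes the
sign. -/
theorem exists_integral_mul_mono (f : R) (j : ℕ) :
    ∃ G : PDO d, IsPos G ∧ partialPow (-1) * mono f (j : ℤ) =
      G + partialPow (-1) * const ((-1) ^ j * (⇑d)^[j] f) := by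
  induction j with
  | zero => exact ⟨0, isPos_zero, by simp [const]⟩
  | succ j ih =>
    obtain ⟨G, hG, h⟩ := ih
    refine ⟨G * partialPow 1 + const ((-1) ^ j * (⇑d)^[j] f),
      (hG.mul isPos_partial).add (isPos_const _), ?_⟩
    have e : d ((-1) ^ j * (⇑d)^[j] f) = -((-1) ^ (j + 1) * (⇑d)^[j + 1] f) := by
      -- The sign is an integer, hence is killed by the derivation.
      have h1 : (-1 : R) ^ j = ((-1) ^ j : ℤ) := by push_cast; rfl
      rw [Function.iterate_succ_apply', Derivation.leibniz, h1, Derivation.map_intCast, smul_zero,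
        add_zero, smul_eq_mul, pow_succ]
      push_cast
      ring
    rw [Nat.cast_succ, ← mono_mul_partialPow, ← mul_assoc, h, add_mul, integral_const_partial, e,
      const_neg, mul_neg]
    abel

/-- For a differential operator `E`, the integral part of `∂⁻¹ f E` is `∂⁻¹ E^*(f)`. -/
theorem IsPos.exists_integral_const_mul {E : PDO d} (hE : IsPos E) (f : R) :
    ∃ G : PDO d, IsPos G ∧
      partialPow (-1) * const f * E = G + partialPow (-1) * const (adjAct E f) := by
  obtain ⟨a, ha⟩ := E.exists_ordLE
  obtain ⟨K, hK⟩ := exists_nat_gt a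
  have hsum : E = ∑ j ∈ Finset.range K, mono (E.coeff j) (j : ℤ) := by
    ext n
    simp only [sum_coeff, mono_coeff]
    rcases lt_or_ge n 0 with hn | hn
    · rw [hE n hn, Finset.sum_eq_zero]
      intro j _
      rw [if_neg (by omega)]
    · lift n to ℕ using hn
      simp only [Nat.cast_inj]
      rw [Finset.sum_ite_eq]
      split_ifs with h
      · rfl
      · exact ha _ (by rw [Finset.mem_range] at h; omega)
  have hadj : adjAct E f =
      ∑ j ∈ Finset.range K, (-1) ^ j * (⇑d)^[j] (E.coeff j * f) := by
    rw [adjAct, finsum_eq_sum_of_support_subset]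
    intro j hj
    rw [Finset.coe_range, Set.mem_Iio]
    by_contra h
    exact hj (by simp only [ha j (by omega), zero_mul, iterate_map_zero, mul_zero])
  choose G hG h using fun j : ℕ => exists_integral_mul_mono (d := d) (f * E.coeff j) j
  refine ⟨∑ j ∈ Finset.range K, G j, IsPos.sum fun j _ => hG j, ?_⟩
  rw [hadj, const_sum, Finset.mul_sum, ← Finset.sum_add_distrib, mul_assoc]
  conv_lhs => rw [hsum, Finset.mul_sum, Finset.mul_sum]
  refine Finset.sum_congr rfl fun j _ => ?_
  rw [const_mul_mono, h j, mul_comm f]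

/-- The integral part of `E a ∂⁻¹ b` for a differential operator `E`. -/
theorem IsPos.exists_mul_rankOne {E : PDO d} (hE : IsPos E) (a b : R) :
    ∃ G : PDO d, IsPos G ∧ E * rankOne d a b = G + rankOne d ((E * const a).coeff 0) b := by
  obtain ⟨F, hF, h⟩ := (hE.mul (isPos_const a)).exists_mul_integral
  refine ⟨F * const b, hF.mul (isPos_const b), ?_⟩
  rw [rankOne, ← mul_assoc, ← mul_assoc, h, add_mul]
  rfl

theorem IsPos.exists_rankOne_mul {E : PDO d} (hE : IsPos E) (a b : R) :
    ∃ G : PDO d, IsPos G ∧ rankOne d a b * E = G + rankOne d a (adjAct E b) := by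
  obtain ⟨G, hG, h⟩ := hE.exists_integral_const_mul b
  refine ⟨const a * G, (isPos_const a).mul hG, ?_⟩
  rw [rankOne, rankOne, mul_assoc (const a), mul_assoc (const a), h, mul_add, ← mul_assoc]

/-! ### Derivations acting on coefficients. -/

@[simp] theorem map_coeff (δ : Derivation ℚ R R) (A : PDO d) (n : ℤ) :
    (A.map δ).coeff n = δ (A.coeff n) := rfl

theorem map_add (δ : Derivation ℚ R R) (A B : PDO d) : (A + B).map δ = A.map δ + B.map δ := by
  ext n
  simp

theorem map_const (δ : Derivation ℚ R R) (f : R) : (const f : PDO d).map δ = const (δ f) := by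
  ext n
  simp only [map_coeff, const, mono_coeff]
  split_ifs <;> simp

theorem map_partialPow (δ : Derivation ℚ R R) (i : ℤ) : (partialPow i : PDO d).map δ = 0 := by
  ext n
  simp only [map_coeff, partialPow, mono_coeff]
  split_ifs <;> simp

/-- A derivation commuting with `d` acts on operators as a derivation. -/
theorem map_mul {δ : Derivation ℚ R R} (hδ : ∀ f, δ (d f) = d (δ f)) (A B : PDO d) :
    (A * B).map δ = A.map δ * B + A * B.map δ := by
  have hiter : ∀ (m : ℕ) f, δ ((⇑d)^[m] f) = (⇑d)^[m] (δ f) := fun m f =>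
    (Function.Commute.iterate_right (f := ⇑δ) (g := ⇑d) hδ m) f
  obtain ⟨a, hA⟩ := A.exists_ordLE
  obtain ⟨b, hB⟩ := B.exists_ordLE
  have hA' : OrdLE (A.map δ) a := fun n hn => by rw [map_coeff, hA n hn, map_zero]
  have hB' : OrdLE (B.map δ) b := fun n hn => by rw [map_coeff, hB n hn, map_zero]
  ext n
  obtain ⟨K, hK⟩ := exists_nat_gt (a + b - n)
  rw [map_coeff, add_coeff, mul_coeff_eq hA hB n le_rfl le_rfl hK,
    mul_coeff_eq hA' hB n le_rfl le_rfl hK, mul_coeff_eq hA hB' n le_rfl le_rfl hK,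
    map_sum, ← Finset.sum_add_distrib]
  refine Finset.sum_congr rfl fun p _ => ?_
  have hrow : δ (row B K p n) = row (B.map δ) K p n := by
    simp only [row, map_sum, map_zsmul, hiter, map_coeff]
  rw [Derivation.leibniz, smul_eq_mul, smul_eq_mul, hrow, map_coeff]
  ring

theorem map_rankOne {δ : Derivation ℚ R R} (hδ : ∀ f, δ (d f) = d (δ f)) (a b : R) :
    (rankOne d a b).map δ = rankOne d (δ a) b + rankOne d a (δ b) := by
  simp only [rankOne, map_mul hδ, map_const, map_partialPow, mul_zero, add_zero]

end PDO

/-! ### The integral part of the powers of the Lax operator. -/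

section

open PDO

variable {R : Type*} [CommRing R] [Algebra ℚ R] {d : Derivation ℚ R R}

theorem laxOp_eq (d : Derivation ℚ R R) (q r : R) : laxOp d q r = partialPow 1 + rankOne d q r := rfl

namespace PDO

theorem IsPos.mul_partial_coeff_zero {A : PDO d} (hA : IsPos A) :
    (A * partialPow 1).coeff 0 = 0 := by
  rw [mul_partialPow_coeff]
  exact hA _ (by norm_num)

/-- For a differential operator `C`, `(C * const f).coeff 0` is the value `C(f)`; this is the rule
`(AB)(f) = A(B(f))`. -/
theorem mul_const_coeff_zero {A B : PDO d} (hA : IsPos A) (hB : IsPos B) (f : R) :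
    (A * B * const f).coeff 0 = (A * const ((B * const f).coeff 0)).coeff 0 := by
  obtain ⟨F, hF, h⟩ := (hB.mul (isPos_const f)).exists_eq_mul_partial_add
  conv_lhs => rw [mul_assoc, h, mul_add, ← mul_assoc, add_coeff,
    (hA.mul hF).mul_partial_coeff_zero, zero_add]

theorem partial_mul_const_coeff_zero (f : R) :
    (partialPow 1 * const f : PDO d).coeff 0 = d f := by
  rw [partial_mul_const, add_coeff, (isPos_const f).mul_partial_coeff_zero, zero_add,
    const_coeff_zero]

theorem const_mul_const_coeff_zero (f g : R) : (const f * const g : PDO d).coeff 0 = f * g := by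
  rw [const_mul_const, const_coeff_zero]

end PDO

namespace LaxOrbit

variable {q r : R} (O : LaxOrbit d q r)

/-- The operator `∑_{j < k} L^{k-1-j}(q) ∂⁻¹ (L^*)^j(r)`. -/
noncomputable def powNeg (k : ℕ) : PDO d :=
  ∑ j ∈ Finset.range k, rankOne d (O.Q (k - 1 - j)) (O.P j)

theorem rankOne_mul_laxOp (i j : ℕ) : rankOne d (O.Q i) (O.P j) * laxOp d q r =
    const (O.Q i * O.P j) + rankOne d (O.Q i) (O.P (j + 1)) +
      rankOne d (O.Q i * O.J j 0) r := by
  have h : d (O.J j 0) = O.P j * q := by rw [O.d_J, O.Q_zero]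
  rw [laxOp_eq, mul_add, rankOne_mul_partial, rankOne_mul_rankOne h, O.P_succ, mul_comm r]
  simp only [rankOne_sub_right, rankOne_neg_right]
  abel

theorem laxOp_mul_rankOne (i j : ℕ) : laxOp d q r * rankOne d (O.Q i) (O.P j) =
    const (O.Q i * O.P j) + rankOne d (O.Q (i + 1)) (O.P j) -
      rankOne d q (O.J 0 i * O.P j) := by
  have h : d (O.J 0 i) = r * O.Q i := by rw [O.d_J, O.P_zero]
  rw [laxOp_eq, add_mul, partial_mul_rankOne, rankOne_mul_rankOne h, O.Q_succ]
  simp only [rankOne_add_left]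
  abel

theorem comm_rankOne (i j : ℕ) : PDO.comm (rankOne d (O.Q i) (O.P j)) (laxOp d q r) =
    rankOne d (O.Q i) (O.P (j + 1)) - rankOne d (O.Q (i + 1)) (O.P j) +
      rankOne d (O.Q i * O.J j 0) r + rankOne d q (O.J 0 i * O.P j) := by
  rw [PDO.comm, rankOne_mul_laxOp, laxOp_mul_rankOne]
  abel

theorem powNeg_succ (k : ℕ) : O.powNeg (k + 1) = rankOne d (O.Q k) r +
    ∑ j ∈ Finset.range k, rankOne d (O.Q (k - 1 - j)) (O.P (j + 1)) := by
  rw [powNeg, Finset.sum_range_succ', O.P_zero, add_comm]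
  simp only [Nat.add_sub_cancel, Nat.sub_zero]
  congr 1
  refine Finset.sum_congr rfl fun j hj => ?_
  rw [show k - (j + 1) = k - 1 - j by omega]

/-- Both facts must be proved together: the integral part of `B q ∂⁻¹ r` is `B(q) ∂⁻¹ r`, so the
step needs the values of `B`. The values are `L^k(Q m)` minus the contribution of the integral part,
and `J_sub` propagates them. -/
theorem exists_pow_eq (k : ℕ) : ∃ B : PDO d, IsPos B ∧ laxOp d q r ^ k = B + O.powNeg k ∧
    ∀ m, (B * const (O.Q m)).coeff 0 =
      O.Q (k + m) - ∑ j ∈ Finset.range k, O.Q (k - 1 - j) * O.J j m := by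
  induction k with
  | zero =>
    refine ⟨1, isPos_one, by simp [powNeg], fun m => ?_⟩
    rw [one_mul, const_coeff_zero]
    simp
  | succ k ih =>
    obtain ⟨B, hB, hL, hev⟩ := ih
    obtain ⟨F, hF, hBF⟩ := (hB.mul (isPos_const q)).exists_eq_mul_partial_add
    set α := (B * const q).coeff 0 with hα
    set ρ := ∑ j ∈ Finset.range k, O.Q (k - 1 - j) * O.P j with hρ
    have hα' : α = O.Q k - ∑ j ∈ Finset.range k, O.Q (k - 1 - j) * O.J j 0 := by
      have := hev 0
      rwa [O.Q_zero] at this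
    refine ⟨B * partialPow 1 + F * const r + const ρ,
      ((hB.mul isPos_partial).add (hF.mul (isPos_const r))).add (isPos_const _), ?_, fun m => ?_⟩
    · have h1 : B * rankOne d q r = F * const r + rankOne d α r := by
        rw [rankOne, ← mul_assoc, ← mul_assoc, hBF, add_mul, mul_assoc F, partial_mul_integral,
          mul_one, add_mul, rankOne]
      have h2 : O.powNeg k * laxOp d q r = const ρ +
          ∑ j ∈ Finset.range k, rankOne d (O.Q (k - 1 - j)) (O.P (j + 1)) +
            rankOne d (∑ j ∈ Finset.range k, O.Q (k - 1 - j) * O.J j 0) r := by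
        rw [powNeg, Finset.sum_mul, hρ, const_sum, rankOne_sum_left, ← Finset.sum_add_distrib,
          ← Finset.sum_add_distrib]
        exact Finset.sum_congr rfl fun j _ => O.rankOne_mul_laxOp _ _
      rw [pow_succ, hL, add_mul, h2, laxOp_eq, mul_add, h1, hα', powNeg_succ, rankOne_sub_left]
      abel
    · have hJ : d (O.J 0 m) = r * O.Q m := by rw [O.d_J, O.P_zero]
      -- `F` is known only through `B q = F ∂ + α`, so it is evaluated at `r Q_m` by writing this as
      -- the derivative of `J 0 m`.
      have e1 : (F * const r * const (O.Q m)).coeff 0 =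
          (B * const (q * O.J 0 m)).coeff 0 - α * O.J 0 m := by
        have h1 : F * const r * const (O.Q m) =
            B * const (q * O.J 0 m) - const (α * O.J 0 m) - F * const (O.J 0 m) * partialPow 1 := by
          rw [← const_mul_const, ← const_mul_const, ← mul_assoc, hBF, mul_assoc, const_mul_const,
            ← hJ, add_mul, add_sub_cancel_right, mul_assoc, mul_assoc, partial_mul_const, mul_add,
            add_sub_cancel_left]
        rw [h1, sub_coeff, (hF.mul (isPos_const _)).mul_partial_coeff_zero, sub_zero, sub_coeff,
          const_coeff_zero]
      have e2 : (B * partialPow 1 * const (O.Q m)).coeff 0 +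
          (B * const (q * O.J 0 m)).coeff 0 = (B * const (O.Q (m + 1))).coeff 0 := by
        rw [mul_const_coeff_zero hB isPos_partial, partial_mul_const_coeff_zero, O.Q_succ,
          const_add, mul_add, add_coeff]
      have hs : ∑ j ∈ Finset.range k, O.Q (k - 1 - j) * O.J j (m + 1) =
          ∑ j ∈ Finset.range k, O.Q (k - 1 - j) * O.J (j + 1) m + ρ * O.Q m +
            (∑ j ∈ Finset.range k, O.Q (k - 1 - j) * O.J j 0) * O.J 0 m := by
        rw [hρ, Finset.sum_mul, Finset.sum_mul, ← Finset.sum_add_distrib, ← Finset.sum_add_distrib]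
        exact Finset.sum_congr rfl fun j _ => by
          linear_combination O.Q (k - 1 - j) * O.J_sub j m
      have ht : ∑ j ∈ Finset.range (k + 1), O.Q (k + 1 - 1 - j) * O.J j m =
          ∑ j ∈ Finset.range k, O.Q (k - 1 - j) * O.J (j + 1) m + O.Q k * O.J 0 m := by
        rw [Finset.sum_range_succ']
        simp only [Nat.add_sub_cancel, Nat.sub_zero]
        congr 1
        refine Finset.sum_congr rfl fun j hj => ?_
        rw [show k - (j + 1) = k - 1 - j by omega]
      rw [add_mul, add_mul, add_coeff, add_coeff, e1, const_mul_const_coeff_zero, ht]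
      have e3 := hev (m + 1)
      rw [hs, show k + (m + 1) = k + 1 + m by ring] at e3
      linear_combination e2 + e3 - O.J 0 m * hα'

theorem ordLE_powNeg (k : ℕ) : OrdLE (O.powNeg k) (-1) := fun n hn => by
  rw [powNeg, sum_coeff]
  exact Finset.sum_eq_zero fun j _ => ordLE_rankOne _ _ n hn

/-- The integral part of `L^k` is `∑_{j < k} L^{k-1-j}(q) ∂⁻¹ (L^*)^j(r)`. -/
theorem negPart_pow (k : ℕ) : negPart (laxOp d q r ^ k) = O.powNeg k := by
  obtain ⟨B, hB, hL, -⟩ := O.exists_pow_eq k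
  exact negPart_eq_of_add hL hB (O.ordLE_powNeg k)

end LaxOrbit


/-! ### Conjugation by `T_I(r)`. -/

section Gauge

theorem gaugeI_eq (d : Derivation ℚ R R) (r : Rˣ) : gaugeI d r = rankOne d (↑r⁻¹ : R) r := rfl

theorem gaugeIInv_eq (d : Derivation ℚ R R) (r : Rˣ) :
    gaugeIInv d r = partialPow 1 + const ((↑r⁻¹ : R) * d r) := by
  rw [gaugeIInv, mul_assoc, partial_mul_const, mul_add, ← mul_assoc, const_mul_const,
    const_mul_const, Units.inv_mul, const_one, one_mul]

theorem gaugeI_mul_gaugeIInv (d : Derivation ℚ R R) (r : Rˣ) : gaugeI d r * gaugeIInv d r = 1 := by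
  simp only [gaugeI, gaugeIInv, mul_assoc, const_mul_const_mul, Units.mul_inv, const_one, one_mul,
    integral_mul_partial_mul]
  rw [const_mul_const, Units.inv_mul, const_one]

theorem gaugeIInv_mul_gaugeI (d : Derivation ℚ R R) (r : Rˣ) : gaugeIInv d r * gaugeI d r = 1 := by
  simp only [gaugeI, gaugeIInv, mul_assoc, const_mul_const_mul, Units.mul_inv, const_one, one_mul,
    partial_mul_integral_mul]
  rw [const_mul_const, Units.inv_mul, const_one]

theorem isPos_gaugeIInv (d : Derivation ℚ R R) (r : Rˣ) : IsPos (gaugeIInv d r) := by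
  rw [gaugeIInv_eq]
  exact isPos_partial.add (isPos_const _)

theorem ordLE_gaugeIInv (d : Derivation ℚ R R) (r : Rˣ) : OrdLE (gaugeIInv d r) 1 := by
  rw [gaugeIInv_eq]
  exact (ordLE_partialPow 1).add ((ordLE_const _).mono zero_le_one)

theorem ordLE_gaugeI (d : Derivation ℚ R R) (r : Rˣ) : OrdLE (gaugeI d r) (-1) := ordLE_rankOne _ _

theorem mul_deriv_inv_mul (r : Rˣ) (f : R) :
    (r : R) * d ((↑r⁻¹ : R) * f) = d f - f * (↑r⁻¹ * d r) := by
  have h2 : (↑r⁻¹ : R) * r = 1 := Units.inv_mul r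
  rw [Derivation.leibniz, deriv_unit_inv, smul_eq_mul, smul_eq_mul]
  linear_combination (d f - f * (↑r⁻¹ : R) * d r) * h2

theorem rankOne_mul_gaugeIInv (r : Rˣ) (a b : R) : rankOne d a b * gaugeIInv d r =
    const (a * b) - rankOne d a (r * d ((↑r⁻¹ : R) * b)) := by
  rw [gaugeIInv_eq, mul_add, rankOne_mul_partial, rankOne_mul_const, mul_deriv_inv_mul,
    rankOne_sub_right]
  abel

theorem gauge_rankOne (r : Rˣ) {a F : R} (hF : d F = r * a) (b : R) :
    gaugeI d r * rankOne d a b * gaugeIInv d r =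
      rankOne d (↑r⁻¹ * F) (-(r * d ((↑r⁻¹ : R) * b))) +
        rankOne d (↑r⁻¹ : R) (r * d ((↑r⁻¹ : R) * (F * b))) := by
  rw [gaugeI_eq, rankOne_mul_rankOne hF, sub_mul, rankOne_mul_gaugeIInv, rankOne_mul_gaugeIInv,
    rankOne_neg_right, mul_assoc (↑r⁻¹ : R) F b]
  abel

/-- Conjugation by `T_I(r)` preserves the integral part up to a term of rank one. -/
theorem gauge_negPart (r : Rˣ) (A : PDO d) :
    gaugeI d r * negPart A * gaugeIInv d r = negPart (gaugeI d r * A * gaugeIInv d r) +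
      rankOne d (↑r⁻¹ : R) (r * d ((↑r⁻¹ : R) * adjAct (posPart A) r)) := by
  -- The discrepancy comes from `A_+`: the integral part of `T A_+` is `r⁻¹ ∂⁻¹ A_+^*(r)`, and `T⁻¹`
  -- turns it into a function plus an operator `r⁻¹ ∂⁻¹ f`.
  obtain ⟨G, hG, h⟩ := (isPos_posPart A).exists_rankOne_mul (↑r⁻¹ : R) (r : R)
  set b := adjAct (posPart A) (r : R)
  have e : gaugeI d r * A * gaugeIInv d r =
      (G * gaugeIInv d r + const (↑r⁻¹ * b)) + (gaugeI d r * negPart A * gaugeIInv d r -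
        rankOne d (↑r⁻¹ : R) (r * d ((↑r⁻¹ : R) * b))) := by
    conv_lhs => rw [← posPart_add_negPart A, mul_add, add_mul, gaugeI_eq, h, add_mul,
      rankOne_mul_gaugeIInv]
    rw [gaugeI_eq]
    abel
  rw [negPart_eq_of_add e ((hG.mul (isPos_gaugeIInv d r)).add (isPos_const _))]
  · abel
  · refine OrdLE.sub (OrdLE.mono (((ordLE_gaugeI d r).mul (ordLE_negPart A)).mul
      (ordLE_gaugeIInv d r)) (by norm_num)) (ordLE_rankOne _ _)

theorem map_gaugeI {δ : Derivation ℚ R R} (hδ : ∀ f, δ (d f) = d (δ f)) (r : Rˣ) :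
    (gaugeI d r).map δ * gaugeIInv d r =
      -rankOne d (↑r⁻¹ : R) (r * d ((↑r⁻¹ : R) * δ r)) := by
  have h2 : (↑r⁻¹ : R) * r = 1 := Units.inv_mul r
  rw [gaugeI_eq, map_rankOne hδ, add_mul, rankOne_mul_gaugeIInv, rankOne_mul_gaugeIInv, h2,
    Derivation.map_one_eq_zero, mul_zero, rankOne_zero_right, sub_zero, deriv_unit_inv δ,
    show -((↑r⁻¹ : R) * ↑r⁻¹ * δ r) * r = -(↑r⁻¹ * δ r) by
      linear_combination (-(↑r⁻¹ : R) * δ r) * h2, const_neg]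
  abel

/-- Since `T⁻¹ = r⁻¹ ∂ r`, the product `q ∂⁻¹ r T⁻¹` is the function `q r`. What remains is `∂ + r⁻¹
∂⁻¹ · r ∂(r⁻¹ r_x + J_{00})`, and `gauge_aux` identifies the bracket with `-r⁻¹ L^*(r)`. -/
theorem gauge_laxOp {q : R} {r : Rˣ} (O : LaxOrbit d q (r : R)) :
    gaugeI d r * laxOp d q r * gaugeIInv d r =
      laxOp d (↑r⁻¹ : R) (-((r : R) * d ((↑r⁻¹ : R) * O.P 1))) := by
  have h2 : (↑r⁻¹ : R) * r = 1 := Units.inv_mul r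
  have hq : rankOne d q (r : R) * gaugeIInv d r = const (q * r) := by
    rw [rankOne_mul_gaugeIInv, h2, Derivation.map_one_eq_zero, mul_zero, rankOne_zero_right,
      sub_zero]
  have h1 : gaugeI d r * partialPow 1 * gaugeIInv d r =
      partialPow 1 + rankOne d (↑r⁻¹ : R) (r * d ((↑r⁻¹ : R) * d r)) := by
    rw [gaugeI_eq, rankOne_mul_partial, h2, const_one, sub_mul, one_mul, rankOne_mul_gaugeIInv,
      gaugeIInv_eq]
    abel
  rw [laxOp_eq, mul_add, add_mul, h1, mul_assoc, hq, gaugeI_eq, rankOne_mul_const, laxOp_eq,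
    add_assoc, ← rankOne_add_right, O.gauge_aux.1, map_sub, map_neg, O.d_J, O.P_zero, O.Q_zero]
  congr 2
  ring

namespace PDO

/-- A derivation applied to a conjugate. -/
theorem map_conj {δ : Derivation ℚ R R} (hδ : ∀ f, δ (d f) = d (δ f)) {T T' L A : PDO d}
    (hTT' : T * T' = 1) (hT'T : T' * T = 1) (hL : L.map δ = PDO.comm A L) :
    (T * L * T').map δ = PDO.comm (T.map δ * T' + T * A * T') (T * L * T') := by
  have h0 : T.map δ * T' + T * T'.map δ = 0 := by
    rw [← map_mul hδ, hTT']
    exact (map_const δ 1).trans (by rw [Derivation.map_one_eq_zero, const_zero])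
  have h1 : T'.map δ = -(T' * (T.map δ * T')) := by
    rw [eq_neg_of_add_eq_zero_left h0, mul_neg, neg_neg, ← mul_assoc, hT'T, one_mul]
  have c : ∀ X : PDO d, T' * (T * X) = X := fun X => by rw [← mul_assoc, hT'T, one_mul]
  rw [map_mul hδ, map_mul hδ, h1, hL, PDO.comm, PDO.comm]
  simp only [add_mul, mul_add, sub_mul, mul_sub, mul_neg, mul_assoc, c]
  abel

theorem conj_pow_of_inverse {T T' L : PDO d} (hTT' : T * T' = 1) (hT'T : T' * T = 1) (k : ℕ) :
    (T * L * T') ^ k = T * L ^ k * T' := by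
  induction k with
  | zero => rw [pow_zero, pow_zero, mul_one, hTT']
  | succ k ih =>
    rw [pow_succ, ih, pow_succ]
    simp only [mul_assoc]
    rw [← mul_assoc T' T, hT'T, one_mul]

theorem comm_pow_self (L : PDO d) (n : ℕ) : PDO.comm (L ^ n) L = 0 := by
  rw [PDO.comm, ← pow_succ, ← pow_succ', sub_self]

theorem comm_add_left (A B L : PDO d) : PDO.comm (A + B) L = PDO.comm A L + PDO.comm B L := by
  simp only [PDO.comm, add_mul, mul_add]
  abel

theorem comm_neg_left (A L : PDO d) : PDO.comm (-A) L = -PDO.comm A L := by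
  simp only [PDO.comm, neg_mul, mul_neg]
  abel

end PDO

/-- The time flows of the transformed operator. -/
theorem map_gauge_laxOp {δ : Derivation ℚ R R} (hδ : ∀ f, δ (d f) = d (δ f)) {q : R} {r : Rˣ}
    (O : LaxOrbit d q (r : R)) (n : ℕ)
    (hL : (laxOp d q (r : R)).map δ = PDO.comm (posPart (laxOp d q (r : R) ^ n)) (laxOp d q (r : R)))
    (hr : δ r = -adjAct (posPart (laxOp d q (r : R) ^ n)) r) :
    (gaugeI d r * laxOp d q r * gaugeIInv d r).map δ =
      -PDO.comm (O.gauge.powNeg n) (gaugeI d r * laxOp d q r * gaugeIInv d r) := by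
  -- `B_n` may be replaced by `-(L^n)_-` because `L^n` commutes with `L`.
  have hL' : (laxOp d q (r : R)).map δ =
      PDO.comm (-negPart (laxOp d q (r : R) ^ n)) (laxOp d q (r : R)) := by
    rw [hL, eq_comm, ← sub_eq_zero, sub_eq_add_neg, ← comm_neg_left, ← comm_add_left, ← neg_add,
      add_comm (PDO.negPart _), PDO.posPart_add_negPart, comm_neg_left, comm_pow_self, neg_zero]
  rw [map_conj hδ (gaugeI_mul_gaugeIInv d r) (gaugeIInv_mul_gaugeI d r) hL', ← comm_neg_left]
  congr 1
  -- As `δr = -B_n^*(r)`, the term of `(δT)T⁻¹` cancels the discrepancy from `gauge_negPart`.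
  rw [map_gaugeI hδ, hr, mul_neg, mul_neg, neg_mul, gauge_negPart, ← O.gauge.negPart_pow,
    ← gauge_laxOp, conj_pow_of_inverse (gaugeI_mul_gaugeIInv d r) (gaugeIInv_mul_gaugeI d r)]
  simp only [mul_neg, map_neg, rankOne_neg_right]
  abel

end Gauge

/-! ### A functional detecting the variation of `r`. -/

namespace PDO

/-- A functional of the first two integral coefficients of `Z` that vanishes on all `a ∂⁻¹ r`. -/
noncomputable def residueForm (r : R) : PDO d →+ R where
  toFun Z := Z.coeff (-2) * r + Z.coeff (-1) * d r
  map_zero' := by simp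
  map_add' A B := by
    simp only [add_coeff]
    ring

theorem residueForm_apply (r : R) (Z : PDO d) :
    residueForm r Z = Z.coeff (-2) * r + Z.coeff (-1) * d r := rfl

/-- The two coefficients `a b` and `-a b'` combine to `-a` times the Wronskian `r b' - r' b = r²
(b/r)'`. The same expression `r ∂(r⁻¹ b)` appears when `T` is conjugated past an integral part. -/
theorem residueForm_rankOne (r : Rˣ) (a b : R) :
    residueForm (r : R) (rankOne d a b) = -(a * r * (r * d ((↑r⁻¹ : R) * b))) := by
  have h2 : (↑r⁻¹ : R) * r = 1 := Units.inv_mul r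
  rw [residueForm_apply, rankOne_coeff_neg_one, rankOne_coeff_neg_two, mul_deriv_inv_mul]
  linear_combination (-(a * b * d r)) * h2

theorem residueForm_rankOne_self (r a : R) : residueForm r (rankOne d a r) = 0 := by
  rw [residueForm_apply, rankOne_coeff_neg_one, rankOne_coeff_neg_two]
  ring

theorem IsPos.residueForm {A : PDO d} (hA : IsPos A) (r : R) : residueForm r A = 0 := by
  rw [residueForm_apply, hA _ (by norm_num), hA _ (by norm_num), zero_mul, zero_mul, add_zero]

theorem residueForm_negPart (r : R) (A : PDO d) :
    PDO.residueForm r (negPart A) = PDO.residueForm r A := by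
  conv_rhs => rw [← posPart_add_negPart A, _root_.map_add, (isPos_posPart A).residueForm, zero_add]

/-- The integral part of the commutator is `A_+(q) ∂⁻¹ r - q ∂⁻¹ A_+^*(r)`, and the form kills the
first term. The result is `q r` times the discrepancy in `gauge_negPart`. -/
theorem residueForm_comm_posPart (q : R) (r : Rˣ) (A : PDO d) :
    PDO.residueForm (r : R) (PDO.comm (posPart A) (laxOp d q r)) =
      q * r * (r * d ((↑r⁻¹ : R) * adjAct (posPart A) r)) := by
  obtain ⟨G, hG, h⟩ := (isPos_posPart A).exists_rankOne_mul q (r : R)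
  obtain ⟨F, hF, h'⟩ := (isPos_posPart A).exists_mul_rankOne q (r : R)
  have e : PDO.comm (posPart A) (laxOp d q r) = (posPart A * partialPow 1 - partialPow 1 * posPart A
      + F - G) + rankOne d ((posPart A * const q).coeff 0) r -
        rankOne d q (adjAct (posPart A) r) := by
    rw [PDO.comm, laxOp_eq, mul_add, add_mul, h, h']
    abel
  rw [e, _root_.map_sub, _root_.map_add, residueForm_rankOne_self, residueForm_rankOne,
    IsPos.residueForm]
  · ring
  · exact ((((isPos_posPart A).mul isPos_partial).sub (isPos_partial.mul (isPos_posPart A))).add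
      hF).sub hG

end PDO

end

/-! ### Coefficientwise convergent sums of operators. -/

namespace PDO

variable {R : Type*} [CommRing R] [Algebra ℚ R] {d : Derivation ℚ R R}

theorem mul_const_eq (A : PDO d) {f : R} (hf : d f = 0) : A * const f = const f * A := by
  ext n
  rw [const_mul_coeff, mul_coeff, finsum_eq_single _ (n, 0)]
  · simp [const, mono_coeff, mul_comm]
  · rintro ⟨p, m⟩ h
    simp only [const, mono_coeff]
    split_ifs with hj
    · have hm : m ≠ 0 := by
        rintro rfl
        exact h (by simp only [Prod.mk.injEq, and_true]; push_cast at hj; omega)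
      obtain ⟨k, rfl⟩ := Nat.exists_eq_succ_of_ne_zero hm
      rw [Function.iterate_succ_apply, hf, iterate_map_zero, mul_zero, smul_zero]
    · rw [iterate_map_zero, mul_zero, smul_zero]

theorem partial_mul_mono (f : R) (i : ℤ) :
    (partialPow 1 * mono f i : PDO d) = mono f i * partialPow 1 + mono (d f) i := by
  rw [← const_mul_partialPow, ← mul_assoc, partial_mul_const, add_mul, mul_assoc, mul_assoc,
    partialPow_mul_partialPow, partialPow_mul_partialPow, add_comm (1 : ℤ), const_mul_partialPow,
    const_mul_partialPow]

variable [TopologicalSpace R] {ι : Type*}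

/-- The operators `A l` have bounded order and sum up to `S` coefficientwise. -/
def HasCoeffSum (A : ι → PDO d) (S : PDO d) : Prop :=
  (∃ a, OrdLE S a ∧ ∀ l, OrdLE (A l) a) ∧ ∀ n, HasSum (fun l => (A l).coeff n) (S.coeff n)

variable {A : ι → PDO d} {S : PDO d}

theorem HasCoeffSum.unique [T2Space R] {S' : PDO d} (h : HasCoeffSum A S)
    (h' : HasCoeffSum A S') : S = S' := by
  ext n
  exact (h.2 n).unique (h'.2 n)

theorem hasCoeffSum_const {f : ι → R} {s : R} (h : HasSum f s) :
    HasCoeffSum (fun l => (const (f l) : PDO d)) (const s) := by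
  refine ⟨⟨0, ordLE_const _, fun l => ordLE_const _⟩, fun n => ?_⟩
  simp only [const, mono_coeff]
  split_ifs
  · exact h
  · exact hasSum_zero

variable [IsTopologicalRing R]

theorem HasCoeffSum.sub {B : ι → PDO d} {S' : PDO d} (h : HasCoeffSum A S)
    (h' : HasCoeffSum B S') : HasCoeffSum (fun l => A l - B l) (S - S') := by
  obtain ⟨⟨a, ha, haA⟩, h⟩ := h
  obtain ⟨⟨b, hb, hbB⟩, h'⟩ := h'
  refine ⟨⟨max a b, (ha.mono (le_max_left a b)).sub (hb.mono (le_max_right a b)), fun l =>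
    ((haA l).mono (le_max_left a b)).sub ((hbB l).mono (le_max_right a b))⟩, fun n => ?_⟩
  exact (h n).sub (h' n)

/-- The common order bound lets each coefficient of every product be expanded over the same finite
box, so no infinite sums are interchanged. -/
theorem HasCoeffSum.mul_right (h : HasCoeffSum A S) (C : PDO d) :
    HasCoeffSum (fun l => A l * C) (S * C) := by
  obtain ⟨⟨a, ha, haA⟩, h⟩ := h
  obtain ⟨c, hc⟩ := C.exists_ordLE
  refine ⟨⟨a + c, ha.mul hc, fun l => (haA l).mul hc⟩, fun n => ?_⟩
  obtain ⟨K, hK⟩ := exists_nat_gt (a + c - n)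
  rw [mul_coeff_eq ha hc n le_rfl le_rfl hK]
  simp only [fun l => mul_coeff_eq (haA l) hc n le_rfl le_rfl hK]
  exact hasSum_sum fun p _ => (h p).mul_right _

theorem HasCoeffSum.mul_left (hd : Continuous d) (h : HasCoeffSum A S) (C : PDO d) :
    HasCoeffSum (fun l => C * A l) (C * S) := by
  obtain ⟨⟨a, ha, haA⟩, h⟩ := h
  obtain ⟨c, hc⟩ := C.exists_ordLE
  refine ⟨⟨c + a, hc.mul ha, fun l => hc.mul (haA l)⟩, fun n => ?_⟩
  obtain ⟨K, hK⟩ := exists_nat_gt (c + a - n)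
  rw [mul_coeff_eq hc ha n le_rfl le_rfl hK]
  simp only [fun l => mul_coeff_eq hc (haA l) n le_rfl le_rfl hK]
  refine hasSum_sum fun p _ => HasSum.mul_left _ (hasSum_sum fun m _ => ?_)
  simp only [zsmul_eq_mul]
  refine HasSum.mul_left _ ?_
  clear * - h hd
  generalize n - p + (m : ℤ) = s
  induction m with
  | zero => exact h s
  | succ m ih =>
    simp only [Function.iterate_succ_apply']
    exact ih.map d hd

theorem HasCoeffSum.comm (hd : Continuous d) (h : HasCoeffSum A S) (C : PDO d) :
    HasCoeffSum (fun l => PDO.comm (A l) C) (PDO.comm S C) :=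
  (h.mul_right C).sub (h.mul_left hd C)

theorem HasCoeffSum.residueForm (h : HasCoeffSum A S) (r : R) :
    HasSum (fun l => residueForm r (A l)) (residueForm r S) :=
  ((h.2 (-2)).mul_right r).add ((h.2 (-1)).mul_right (d r))

theorem hasCoeffSum_rankOne (hd : Continuous d) (a : R) {f : ι → R} {s : R} (h : HasSum f s) :
    HasCoeffSum (fun l => rankOne d a (f l)) (rankOne d a s) :=
  (hasCoeffSum_const h).mul_left hd _

end PDO

/-! ### The Orlov–Schulman operator. -/

section

open PDO

namespace TimeAlgebra

variable {R : Type*} [CommRing R] [Algebra ℚ R] [TopologicalSpace R] (τ : TimeAlgebra R)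

/-- The summand `S (l t_l ∂^{l-1}) S⁻¹ L^k` of the operator `M L^k`. -/
noncomputable def orlovTerm (S S' L : PDO τ.dx) (k : ℕ) (l : ℕ+) : PDO τ.dx :=
  S * PDO.mono ((l : ℕ) • τ.t l) ((l : ℤ) - 1) * S' * L ^ k

theorem dx_t (l : ℕ+) : τ.dx (τ.t l) = if l = 1 then 1 else 0 := by
  rw [dx, τ.D_t]
  simp only [eq_comm]

theorem continuous_dx : Continuous τ.dx := τ.D_continuous 1

theorem summable_orlovTerm [IsTopologicalRing R] (S S' L : PDO τ.dx) (k : ℕ) (n : ℤ) :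
    Summable fun l => (τ.orlovTerm S S' L k l).coeff n := by
  -- For `l ≠ 1` the time `t_l` does not depend on `x`, so it commutes with `S` and can be pulled
  -- out in front; `l = 1` is a single exception.
  refine (τ.summable_t fun l => (S * PDO.mono (((l : ℕ) : R)) ((l : ℤ) - 1) * S' *
    L ^ k).coeff n).congr_cofinite ?_
  refine (Set.finite_singleton (1 : ℕ+)).subset fun l hl => ?_
  by_contra h
  have ht : τ.dx (τ.t l) = 0 := by rw [dx_t, if_neg (show ¬l = 1 from h)]
  have e : (l : ℕ) • τ.t l = τ.t l * ((l : ℕ) : R) := by rw [nsmul_eq_mul, mul_comm]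
  refine hl (show τ.t l * _ = (S * _ * S' * L ^ k).coeff n from ?_)
  rw [e, ← const_mul_mono, ← mul_assoc, mul_const_eq S ht, mul_assoc (const _), mul_assoc (const _),
    mul_assoc (const _), const_mul_coeff]

theorem hasCoeffSum_orlovNeg [IsTopologicalRing R] (S S' L : PDO τ.dx) (k : ℕ) :
    HasCoeffSum (fun l => PDO.negPart (τ.orlovTerm S S' L k l)) (τ.orlovNeg S S' L k) := by
  refine ⟨⟨-1, fun n hn => if_neg (by omega), fun l => ordLE_negPart _⟩, fun n => ?_⟩
  rcases lt_or_ge n 0 with hn | hn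
  · simp only [negPart_coeff hn]
    have : (τ.orlovNeg S S' L k).coeff n = ∑' l, (τ.orlovTerm S S' L k l).coeff n := if_pos hn
    rw [this]
    exact (τ.summable_orlovTerm S S' L k n).hasSum
  · have : (τ.orlovNeg S S' L k).coeff n = 0 := if_neg (not_lt.2 hn)
    rw [this]
    simp only [fun l => ordLE_negPart (τ.orlovTerm S S' L k l) n (by omega)]
    exact hasSum_zero

/-- The relation `[L, M] = 1`, for the single summands of `M L^k`. -/
theorem comm_orlovTerm {S S' L : PDO τ.dx} (h : S' * S = 1) (hL : L = S * partialPow 1 * S')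
    (h' : S * S' = 1) (k : ℕ) (l : ℕ+) :
    PDO.comm (τ.orlovTerm S S' L k l) L = if l = 1 then -L ^ k else 0 := by
  set μ : PDO τ.dx := PDO.mono ((l : ℕ) • τ.t l) ((l : ℤ) - 1) with hμ
  have c : ∀ X : PDO τ.dx, S' * (S * X) = X := fun X => by rw [← mul_assoc, h, one_mul]
  have e1 : S * μ * S' * L = S * (μ * partialPow 1) * S' := by
    rw [hL]
    simp only [mul_assoc, c]
  have e2 : L * (S * μ * S') = S * (partialPow 1 * μ) * S' := by
    rw [hL]
    simp only [mul_assoc, c]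
  -- After undressing this is `[l t_l ∂^{l-1}, ∂]`, which is nonzero only for `l = 1`.
  have e : PDO.comm (τ.orlovTerm S S' L k l) L =
      -(S * PDO.mono (τ.dx ((l : ℕ) • τ.t l)) ((l : ℤ) - 1) * S' * L ^ k) := by
    rw [PDO.comm, orlovTerm, ← hμ, mul_assoc _ (L ^ k), ← pow_succ, pow_succ', ← mul_assoc _ L, e1,
      ← mul_assoc L, e2, hμ, partial_mul_mono, mul_add, add_mul, add_mul]
    abel
  rw [e, map_nsmul, dx_t]
  split_ifs with hl
  · subst hl
    have h1 : (PDO.mono (((1 : ℕ+) : ℕ) • (1 : R)) (((1 : ℕ+) : ℤ) - 1) : PDO τ.dx) = 1 := by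
      simp only [PNat.one_coe, one_smul, Nat.cast_one, sub_self]
      rfl
    rw [h1, mul_one, h', one_mul]
  · have h1 : (PDO.mono ((l : ℕ) • (0 : R)) ((l : ℤ) - 1) : PDO τ.dx) = 0 := by
      ext n
      simp [mono_coeff]
    rw [h1, mul_zero, zero_mul, zero_mul, neg_zero]

end TimeAlgebra

/-! ### The ghost operators `X_n^{(1)}`. -/

section Ghost

/-- Summation by parts with weights of increment one; `g 0 = 0` removes the lower boundary term. -/
theorem sum_mul_sub_add_sum {R : Type*} [CommRing R] {e g : ℕ → R} (he : ∀ j, e (j + 1) = e j + 1) (h0 : g 0 = 0) (n : ℕ) :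
    ∑ j ∈ Finset.range n, e j * (g (j + 1) - g j) + ∑ j ∈ Finset.range (n + 1), g j =
      e n * g n := by
  induction n with
  | zero => simp [h0]
  | succ n ih =>
    rw [Finset.sum_range_succ, Finset.sum_range_succ _ (n + 1)]
    linear_combination ih - g (n + 1) * he n

variable {R : Type*} [CommRing R] [Algebra ℚ R] {d : Derivation ℚ R R}

/-- The coefficients `j - (n - 1) / 2` of the ghost operator. -/
def ghostCoeff (R : Type*) [CommRing R] [Algebra ℚ R] (n j : ℕ) : R :=
  algebraMap ℚ R ((j : ℚ) - ((n : ℚ) - 1) / 2)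

theorem ghostCoeff_succ (n j : ℕ) : ghostCoeff R n (j + 1) = ghostCoeff R n j + 1 := by
  rw [ghostCoeff, ghostCoeff, ← map_one (algebraMap ℚ R), ← _root_.map_add]
  congr 1
  push_cast
  ring

theorem deriv_ghostCoeff (d : Derivation ℚ R R) (n j : ℕ) : d (ghostCoeff R n j) = 0 :=
  d.map_algebraMap _

namespace PDO

theorem const_mul_rankOne_of_deriv_eq_zero {e : R} (he : d e = 0) (a b : R) :
    const e * rankOne d a b = rankOne d a (e * b) := by
  rw [← mul_const_eq _ he, rankOne_mul_const, mul_comm]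

theorem residueForm_const_mul (r e : R) (A : PDO d) :
    PDO.residueForm r (const e * A) = e * PDO.residueForm r A := by
  rw [residueForm_apply, residueForm_apply, const_mul_coeff, const_mul_coeff]
  ring

theorem comm_const_mul {e : R} (he : d e = 0) (A L : PDO d) :
    PDO.comm (const e * A) L = const e * PDO.comm A L := by
  rw [PDO.comm, PDO.comm, ← mul_assoc L, mul_const_eq L he, mul_assoc, mul_assoc, mul_sub]

end PDO

namespace LaxOrbit

theorem ghost_eq {q r : R} (O : LaxOrbit d q r) (n : ℕ) : O.ghost n = ∑ j ∈ Finset.range n,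
    const (ghostCoeff R n j) * rankOne d (O.Q (n - 1 - j)) (O.P j) := by
  refine Finset.sum_congr rfl fun j _ => ?_
  rw [const_mul_rankOne, ghostCoeff, ← Algebra.smul_def]
  rfl

variable {q : R} {r : Rˣ} (O : LaxOrbit d q (r : R))

/-- The function `(T^*)⁻¹((L^*)^j(r))`. -/
def dualP (j : ℕ) : R := -((r : R) * d ((↑r⁻¹ : R) * O.P j))

theorem dualP_zero : O.dualP 0 = 0 := by
  rw [dualP, O.P_zero, Units.inv_mul, Derivation.map_one_eq_zero, mul_zero, neg_zero]

theorem gauge_P (j : ℕ) : O.gauge.P j = O.dualP (j + 1) := rfl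

theorem gauge_Q_zero : O.gauge.Q 0 = (↑r⁻¹ : R) := rfl

/-- The correction term in the gauge transformation of the ghost operator. -/
def ghostCorrection (n : ℕ) : R := ∑ j ∈ Finset.range n,
  ghostCoeff R n j * (r * d ((↑r⁻¹ : R) * (O.J 0 (n - 1 - j) * O.P j)))

/-- By `comm_rankOne`, the commutator is a weighted sum of differences up to terms with a factor `q`
or `r`. Summation by parts turns the differences into minus the integral part of `L^{n+1}` and the
boundary term at `j = n`. -/
theorem residueForm_comm_ghost (n : ℕ) :
    PDO.residueForm (r : R) (PDO.comm (O.ghost n) (laxOp d q r)) +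
      PDO.residueForm (r : R) (laxOp d q r ^ (n + 1)) =
        q * r * (ghostCoeff R n n * O.dualP n - O.ghostCorrection n) := by
  set g : ℕ → R := fun j => O.Q (n - j) * O.dualP j with hg
  have h1 : PDO.residueForm (r : R) (laxOp d q r ^ (n + 1)) =
      r * ∑ j ∈ Finset.range (n + 1), g j := by
    rw [← residueForm_negPart, O.negPart_pow, powNeg, map_sum, Finset.mul_sum]
    refine Finset.sum_congr rfl fun j _ => ?_
    simp only [residueForm_rankOne, hg, dualP, Nat.add_sub_cancel]
    ring
  have h2 : PDO.residueForm (r : R) (PDO.comm (O.ghost n) (laxOp d q r)) =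
      r * ∑ j ∈ Finset.range n, ghostCoeff R n j * (g (j + 1) - g j) -
        q * r * O.ghostCorrection n := by
    have hc : PDO.comm (O.ghost n) (laxOp d q r) = ∑ j ∈ Finset.range n,
        const (ghostCoeff R n j) *
          PDO.comm (rankOne d (O.Q (n - 1 - j)) (O.P j)) (laxOp d q r) := by
      rw [PDO.comm, ghost_eq, Finset.sum_mul, Finset.mul_sum, ← Finset.sum_sub_distrib]
      exact Finset.sum_congr rfl fun j _ => comm_const_mul (deriv_ghostCoeff d n j) _ _
    rw [hc, map_sum, ghostCorrection, Finset.mul_sum, Finset.mul_sum, ← Finset.sum_sub_distrib]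
    refine Finset.sum_congr rfl fun j hj => ?_
    rw [Finset.mem_range] at hj
    rw [residueForm_const_mul, comm_rankOne, _root_.map_add, _root_.map_add, _root_.map_sub,
      residueForm_rankOne_self, residueForm_rankOne, residueForm_rankOne, residueForm_rankOne]
    simp only [hg, dualP]
    rw [show n - (j + 1) = n - 1 - j by omega, show n - 1 - j + 1 = n - j by omega]
    ring
  have h3 := sum_mul_sub_add_sum (ghostCoeff_succ (R := R) n) (g := g)
    (by simp only [hg, dualP_zero, mul_zero]) n
  have h4 : g n = q * O.dualP n := by simp only [hg, Nat.sub_self, O.Q_zero]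
  rw [h4] at h3
  rw [h1, h2]
  linear_combination (r : R) * h3

/-- Conjugation takes `Q (n-1-j) ∂⁻¹ P j` to `Q̃ (n-j) ∂⁻¹ P̃ (j-1)` plus a correction, and `j = 0`
drops out by `dualP_zero`. Reindexing raises each weight by one, which produces `powNeg`; the term
`j = n` is missing from the left side and is subtracted. -/
theorem gauge_ghost (n : ℕ) : gaugeI d r * O.ghost n * gaugeIInv d r =
    O.gauge.ghost n + O.gauge.powNeg n -
      rankOne d (↑r⁻¹ : R) (ghostCoeff R n n * O.dualP n - O.ghostCorrection n) := by
  have h1 : gaugeI d r * O.ghost n * gaugeIInv d r = ∑ j ∈ Finset.range n,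
      const (ghostCoeff R n j) * rankOne d (O.gauge.Q (n - j)) (O.dualP j) +
        rankOne d (↑r⁻¹ : R) (O.ghostCorrection n) := by
    rw [ghost_eq, Finset.mul_sum, Finset.sum_mul, ghostCorrection, rankOne_sum_right,
      ← Finset.sum_add_distrib]
    refine Finset.sum_congr rfl fun j hj => ?_
    rw [Finset.mem_range] at hj
    have hJ : d (O.J 0 (n - 1 - j)) = r * O.Q (n - 1 - j) := by rw [O.d_J, O.P_zero]
    rw [← mul_assoc (gaugeI d r), mul_const_eq _ (deriv_ghostCoeff d n j),
      mul_assoc (const _), mul_assoc (const _), gauge_rankOne r hJ, mul_add,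
      const_mul_rankOne_of_deriv_eq_zero (deriv_ghostCoeff d n j) (↑r⁻¹ : R),
      show n - j = n - 1 - j + 1 by omega]
    rfl
  have h2 : O.gauge.ghost n + O.gauge.powNeg n = ∑ j ∈ Finset.range (n + 1),
      const (ghostCoeff R n j) * rankOne d (O.gauge.Q (n - j)) (O.dualP j) := by
    rw [Finset.sum_range_succ', dualP_zero, rankOne_zero_right, mul_zero, add_zero, ghost_eq,
      powNeg, ← Finset.sum_add_distrib]
    refine Finset.sum_congr rfl fun j _ => ?_
    rw [ghostCoeff_succ, const_add, add_mul, const_one, one_mul, gauge_P,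
      show n - (j + 1) = n - 1 - j by omega]
  rw [h1, h2, Finset.sum_range_succ, Nat.sub_self, gauge_Q_zero,
    const_mul_rankOne_of_deriv_eq_zero (deriv_ghostCoeff d n n), rankOne_sub_right]
  abel

end LaxOrbit

end Ghost

/-! ### The transformed additional flow. -/

section Flow

variable {R : Type*} [CommRing R] [Algebra ℚ R] [TopologicalSpace R] [IsTopologicalRing R]
  [T2Space R] (τ : TimeAlgebra R) {q : R} {r : Rˣ}

/-- Conjugation by `T_I(r)` preserves `(M L^k)_-` up to a term of rank one, which is determined by
the commutator of `(M L^k)_-` with `L`. -/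
theorem exists_gauge_orlovNeg {W W' : PDO τ.dx} (hWW' : W * W' = 1) (hW'W : W' * W = 1)
    (hL : laxOp τ.dx q (r : R) = W * partialPow 1 * W') (k : ℕ) :
    ∃ β : R, gaugeI τ.dx r * τ.orlovNeg W W' (laxOp τ.dx q r) k * gaugeIInv τ.dx r =
        τ.orlovNeg (gaugeI τ.dx r * W) (W' * gaugeIInv τ.dx r)
          (gaugeI τ.dx r * laxOp τ.dx q r * gaugeIInv τ.dx r) k + rankOne τ.dx (↑r⁻¹ : R) β ∧
      PDO.residueForm (r : R)
          (PDO.comm (τ.orlovNeg W W' (laxOp τ.dx q r) k) (laxOp τ.dx q r)) =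
        -PDO.residueForm (r : R) (laxOp τ.dx q r ^ k) - q * r * β := by
  set T := gaugeI τ.dx r with hT
  set T' := gaugeIInv τ.dx r with hT'
  set L := laxOp τ.dx q (r : R) with hLdef
  have hTT' : T * T' = 1 := gaugeI_mul_gaugeIInv _ _
  have hT'T : T' * T = 1 := gaugeIInv_mul_gaugeI _ _
  have hd := τ.continuous_dx
  set Y := τ.orlovTerm W W' L k with hY
  have hYt : ∀ l, τ.orlovTerm (T * W) (W' * T') (T * L * T') k l = T * Y l * T' := fun l => by
    rw [hY, TimeAlgebra.orlovTerm, TimeAlgebra.orlovTerm, conj_pow_of_inverse hTT' hT'T]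
    simp only [mul_assoc]
    rw [← mul_assoc T' T, hT'T, one_mul]
  set b : ℕ+ → R := fun l => r * τ.dx ((↑r⁻¹ : R) * adjAct (posPart (Y l)) r) with hb
  have hN := τ.hasCoeffSum_orlovNeg W W' L k
  have hNt := τ.hasCoeffSum_orlovNeg (T * W) (W' * T') (T * L * T') k
  have hdiff : HasCoeffSum (fun l => rankOne τ.dx (↑r⁻¹ : R) (b l))
      (T * τ.orlovNeg W W' L k * T' - τ.orlovNeg (T * W) (W' * T') (T * L * T') k) := by
    have h := ((hN.mul_left hd T).mul_right T').sub hNt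
    have e : ∀ l, T * PDO.negPart (Y l) * T' -
        PDO.negPart (τ.orlovTerm (T * W) (W' * T') (T * L * T') k l) =
          rankOne τ.dx (↑r⁻¹ : R) (b l) := fun l => by
      rw [hYt, gauge_negPart, add_sub_cancel_left]
    simpa only [← hY, e] using h
  -- Each `b l` is `r` times the coefficient of `∂⁻¹` in its summand, so the convergence of `∑ b l`
  -- comes with that of the operators.
  have hbeta : HasSum b (r * (T * τ.orlovNeg W W' L k * T' -
      τ.orlovNeg (T * W) (W' * T') (T * L * T') k).coeff (-1)) := by
    have h := (hdiff.2 (-1)).mul_left (r : R)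
    simpa only [rankOne_coeff_neg_one, Units.mul_inv_cancel_left] using h
  set β := r * (T * τ.orlovNeg W W' L k * T' -
      τ.orlovNeg (T * W) (W' * T') (T * L * T') k).coeff (-1)
  refine ⟨β, ?_, ?_⟩
  · rw [← (hasCoeffSum_rankOne hd (↑r⁻¹ : R) hbeta).unique hdiff |>.symm]
    abel
  · have h1 := (hN.comm hd L).residueForm (r : R)
    have e : ∀ l, PDO.residueForm (r : R) (PDO.comm (PDO.negPart (Y l)) L) =
        (if l = 1 then -PDO.residueForm (r : R) (L ^ k) else 0) - q * r * b l := fun l => by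
      have h2 : PDO.comm (Y l) L =
          PDO.comm (posPart (Y l)) L + PDO.comm (PDO.negPart (Y l)) L := by
        rw [← comm_add_left, PDO.posPart_add_negPart]
      have h3 := residueForm_comm_posPart q r (Y l)
      have h4 := τ.comm_orlovTerm hW'W hL hWW' k l
      rw [← hY, h2] at h4
      have h5 := congrArg (PDO.residueForm (r : R)) h4
      rw [_root_.map_add, h3, apply_ite (PDO.residueForm (r : R)), _root_.map_neg,
        _root_.map_zero] at h5
      rw [hb, ← h5]
      ring
    simp only [← hY, e] at h1
    refine h1.unique (HasSum.sub ?_ (hbeta.mul_left _))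
    exact hasSum_ite_eq (1 : ℕ+) (-PDO.residueForm (r : R) (L ^ k))

/-- The generator of the additional flow of the transformed operator. -/
theorem gauge_generator (hq : q ∈ nonZeroDivisors R) {W W' : PDO τ.dx} (hWW' : W * W' = 1)
    (hW'W : W' * W = 1) (hL : laxOp τ.dx q (r : R) = W * partialPow 1 * W')
    (O : LaxOrbit τ.dx q (r : R)) (k : ℕ) {δ : Derivation ℚ R R}
    (hδ : ∀ f, δ (τ.dx f) = τ.dx (δ f))
    (hflow : (laxOp τ.dx q (r : R)).map δ = PDO.comm
      (-(τ.orlovNeg W W' (laxOp τ.dx q (r : R)) k) + O.ghost (k - 1)) (laxOp τ.dx q (r : R))) :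
    (gaugeI τ.dx r).map δ * gaugeIInv τ.dx r + gaugeI τ.dx r *
        (-(τ.orlovNeg W W' (laxOp τ.dx q (r : R)) k) + O.ghost (k - 1)) * gaugeIInv τ.dx r =
      -(τ.orlovNeg (gaugeI τ.dx r * W) (W' * gaugeIInv τ.dx r)
          (gaugeI τ.dx r * laxOp τ.dx q r * gaugeIInv τ.dx r) k) + O.gauge.ghost (k - 1) +
        O.gauge.powNeg (k - 1) := by
  obtain ⟨β, hβ, hF⟩ := exists_gauge_orlovNeg τ hWW' hW'W hL k
  set n := k - 1 with hn
  set ν := ghostCoeff R n n * O.dualP n - O.ghostCorrection n with hν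
  have hk : PDO.residueForm (r : R) (PDO.comm (O.ghost n) (laxOp τ.dx q r)) +
      PDO.residueForm (r : R) (laxOp τ.dx q r ^ k) = q * r * ν := by
    -- For `k = 0` the truncated subtraction gives `n = 0`, so `n + 1 ≠ k`; then every term vanishes
    -- separately.
    rcases k with _ | k
    · have h0 : n = 0 := rfl
      rw [hν, h0, LaxOrbit.dualP_zero, LaxOrbit.ghostCorrection, LaxOrbit.ghost, pow_zero,
        isPos_one.residueForm]
      simp [PDO.comm]
    · exact O.residueForm_comm_ghost k
  have hmap : PDO.residueForm (r : R) ((laxOp τ.dx q (r : R)).map δ) =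
      -(q * r * (r * τ.dx ((↑r⁻¹ : R) * δ r))) := by
    rw [laxOp_eq, PDO.map_add, map_partialPow, zero_add, map_rankOne hδ, _root_.map_add,
      residueForm_rankOne_self, zero_add, residueForm_rankOne]
  rw [hflow, comm_add_left, comm_neg_left, _root_.map_add, _root_.map_neg, hF] at hmap
  -- The evolution of `r`, as far as it is needed, is recovered from that of `L` by cancelling `q`
  -- and `r`.
  have hφ : -((r : R) * τ.dx ((↑r⁻¹ : R) * δ r)) = β + ν := by
    have h : q * ((-((r : R) * τ.dx ((↑r⁻¹ : R) * δ r)) - (β + ν)) * r) = 0 := by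
      linear_combination -hmap + hk
    have h' := (mul_right_mem_nonZeroDivisors_eq_zero_iff hq).1 ((mul_comm _ _).trans h)
    exact sub_eq_zero.1 ((Units.mul_left_eq_zero r).1 h')
  rw [mul_add, add_mul, mul_neg, neg_mul, hβ, O.gauge_ghost, map_gaugeI hδ, ← rankOne_neg_right,
    hφ, rankOne_add_right]
  abel

end Flow

end

theorem proposition1 {R : Type*} [CommRing R] [Algebra ℚ R] [TopologicalSpace R]
    [IsTopologicalRing R] [T2Space R] (τ : TimeAlgebra R)
    (q : R) (r : Rˣ) (hq : q ∈ nonZeroDivisors R) (hckp : IsCKP τ q (r : R))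
    (W W' : PDO τ.dx) (hW : IsDressing τ (laxOp τ.dx q (r : R)) W W')
    (O : LaxOrbit τ.dx q (r : R))
    (k : ℕ) (δ : Derivation ℚ R R) (hδ : ∀ f, δ (τ.dx f) = τ.dx (δ f))
    (hflow : (laxOp τ.dx q (r : R)).map δ =
      PDO.comm (-(τ.orlovNeg W W' (laxOp τ.dx q (r : R)) k) + O.ghost (k - 1)) (laxOp τ.dx q (r : R)))
    (T T' Lt : PDO τ.dx) (hT : T = gaugeI τ.dx r) (hT' : T' = gaugeIInv τ.dx r)
    (hLt : Lt = T * laxOp τ.dx q (r : R) * T') :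
    Lt = laxOp τ.dx (↑r⁻¹ : R) (-((r : R) * τ.dx ((↑r⁻¹ : R) * O.P 1))) ∧
    Lt.map δ =
      PDO.comm (-(τ.orlovNeg (T * W) (W' * T') Lt k) + O.gauge.ghost (k - 1)) Lt
        - τ.prevFlow k Lt := by
  subst hT hT' hLt
  refine ⟨gauge_laxOp O, ?_⟩
  have hprev : τ.prevFlow k (gaugeI τ.dx r * laxOp τ.dx q r * gaugeIInv τ.dx r) =
      -PDO.comm (O.gauge.powNeg (k - 1)) (gaugeI τ.dx r * laxOp τ.dx q r * gaugeIInv τ.dx r) := by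
    rw [TimeAlgebra.prevFlow]
    split_ifs with hk
    · exact map_gauge_laxOp (fun f => τ.D_comm _ _ f) O (k - 1)
        (hckp.lax ⟨k - 1, by omega⟩) (hckp.adjEigen ⟨k - 1, by omega⟩)
    -- For `k ≤ 1` the extra operator is the empty sum, in agreement with the convention for the
    -- last term.
    · rw [show k - 1 = 0 by omega, LaxOrbit.powNeg, Finset.sum_range_zero, PDO.comm, zero_mul,
        mul_zero, sub_zero, neg_zero]
  rw [PDO.map_conj hδ (gaugeI_mul_gaugeIInv _ r) (gaugeIInv_mul_gaugeI _ r) hflow,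
    gauge_generator τ hq hW.mul_inv hW.inv_mul hW.dressing O k hδ hflow, PDO.comm_add_left, hprev,
    sub_neg_eq_add]
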